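/- **Setting.** A *unary-binary tree* is a plane tree in which every node has $0$, $1$ or $2$ children; its size is its number of nodes. A *growth procedure* is a Markov chain whose state consists of a unary-binary tree, possibly with auxiliary data, and which starts with a tree of size $1$. At each step an increment $1$ or $2$ is drawn with respective probabilities $2/3$ and $1/3$; the step then either fails or replaces the tree by one whose size is larger by that increment (the probability of failure and the law of the new state may depend on the current state and on the increment). Let $p_n$ be the probability that a tree of size at least $n$ is reached before a step fails. The *anticipated rejection sampler* with target size $n$ runs the procedure until the tree has at least $n$ nodes or a step fails. If the tree then has exactly $n$ nodes, it is output; otherwise (a step failed, or the size jumped from $n-1$ to $n+1$) the procedure is restarted independently from scratch. Let $Y_n$ be the total number of nodes of the trees built, i.e. the sum of the sizes of the last trees of all the trials up to and including the successful one. **The grafting procedure.** The state is a unary-binary tree with a mark, which is either a unary node, or a leaf together with one of two colours $0,1$; a tree of size $m$ has $m+1$ marks. A marked unary node or a leaf of colour $0$ designates itself; a leaf of colour $1$ designates its closest binary ancestor in whose left subtree it lies, if there is one. So each node is designated by exactly one mark, and one mark designates no node. The procedure starts with the one-node tree, marked in a uniformly random colour. With probability $1/3$ each, a step is one of the following. 1.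 Insert a unary node just above the designated node, and mark it. 2. Add a new leaf below the mark: if a leaf is marked, it becomes a unary node whose child is the new leaf, marked in the same colour; if a unary node is marked, it becomes a binary node whose left child is the new leaf, marked in colour $1$. 3. Insert a binary node just above the designated node, whose other child is a new leaf, and mark this leaf. Its side and colour are chosen uniformly among (left, $0$), (right, $1$), (right, $0$). Steps of kind 1 and 3 fail if the mark designates no node. **Distributions.** For $0<\alpha<1$ the Darling–Mandelbrot distribution of parameter $\alpha$ is the probability distribution on $[0,\infty)$ with characteristic function $$\phi_\alpha(s)=\Bigl(1-\sum_{n\ge1}\frac{\alpha}{n-\alpha}\,\frac{(is)^n}{n!}\Bigr)^{-1}.$$ Let $\mathcal D(\alpha)$ be the law of $1+X$ where $X$ has this distribution. For $0<p\le1$ let $\mathcal D(\alpha,p)$ be the law of $V_1+\dots+V_Z$, where the $V_i$ have law $\mathcal D(\alpha)$, where $P(Z=k)=(1-p)^{k-1}p$ for $k\ge1$, and where all these variables are independent. **Proposition.** The grafting procedure satisfies $p_n\sim c\,n^{-1/2}$ for some constant $c>0$, and for the anticipated rejection sampler based on it, as $n\to\infty$, $$\frac{Y_n}{n}\to\mathcal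 D\bigl(\tfrac12,\tfrac34\bigr)\ \text{ in distribution},\qquad \mathbb E(Y_n)\sim\tfrac83\,n,\qquad \mathbb V(Y_n)\sim\tfrac{32}{9}\,n^2 ,$$ where $Y_n$ has a finite second moment for all large $n$. The same three asymptotic statements hold, with a finite second moment for all large $n$, for the anticipated rejection sampler based on any growth procedure with $p_n\sim c\,n^{-1/2}$ for some constant $c>0$. -/

import Mathlib

open MeasureTheory ProbabilityTheory Filter
open scoped Topology Asymptotics

/-! ### Unary-binary trees -/

/-- Unary-binary plane trees. -/
inductive UBTree : Type
  | leaf : UBTree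
  | unary (t : UBTree) : UBTree
  | binary (l r : UBTree) : UBTree

namespace UBTree

/-- The size of a tree: its total number of nodes. -/
def numNodes : UBTree → ℕ
  | leaf => 1
  | unary t => t.numNodes + 1
  | binary l r => l.numNodes + r.numNodes + 1

/-- The set of trees is discrete. -/
instance : MeasurableSpace UBTree := ⊤

/-- One step of the path from a node up to the root: the parent is a unary node (`up`), or a
binary node of which we are the left child (`left r`, with right sibling `r`), or a binary node of
which we are the right child (`right l`, with left sibling `l`). -/
inductive Frame : Type
  | up : Frame
  | left (r : UBTree) : Frame
  | right (l : UBTree) : Frame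

/-- The surroundings of a subtree: the path from its root up to the root of the whole tree. -/
abbrev Context : Type := List Frame

/-- The whole tree, given a subtree and its surroundings. -/
def plug : Context → UBTree → UBTree
  | [], t => t
  | Frame.up :: c, t => plug c (unary t)
  | Frame.left r :: c, t => plug c (binary t r)
  | Frame.right l :: c, t => plug c (binary l t)

/-- The number of nodes of the surroundings of a subtree. -/
def contextNodes : Context → ℕ
  | [] => 0
  | Frame.up :: c => contextNodes c + 1
  | Frame.left r :: c => contextNodes c + r.numNodes + 1
  | Frame.right l :: c => contextNodes c + l.numNodes + 1

theorem numNodes_plug (c : Context) (t : UBTree) :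
    (plug c t).numNodes = contextNodes c + t.numNodes := by
  induction c generalizing t with
  | nil => simp [plug, contextNodes]
  | cons f c ih => cases f <;> simp only [plug, contextNodes, ih, numNodes] <;> omega

/-- Starting from the subtree `t` with surroundings `c`, go up to the first binary ancestor that is
reached from its left child. The result is the subtree rooted at that ancestor, together with its
surroundings. There is no such ancestor exactly if `t` lies at the right end of the tree. -/
def climb : Context → UBTree → Option (Context × UBTree)
  | [], _ => none
  | Frame.up :: c, t => climb c (unary t)
  | Frame.right l :: c, t => climb c (binary l t)
  | Frame.left r :: c, t => some (c, binary t r)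

theorem plug_climb {c : Context} {t : UBTree} {q : Context × UBTree}
    (h : climb c t = some q) : plug q.1 q.2 = plug c t := by
  induction c generalizing t with
  | nil => simp [climb] at h
  | cons f c ih =>
    cases f with
    | up => exact ih h
    | left r => simp only [climb, Option.some.injEq] at h; subst h; rfl
    | right l => exact ih h

end UBTree

open UBTree

/-! ### Growth procedures and anticipated rejection -/

/-- A randomized procedure that lets a unary-binary tree grow from one node upwards. A state in `S`
consists of the current tree and possibly some auxiliary data. A growth step adds either one node
(`growOne`) or two nodes (`growTwo`) to the tree, or fails (`none`). -/
structure GrowthProcedure (S : Type*) where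
  tree : S → UBTree
  init : PMF S
  growOne : S → PMF (Option S)
  growTwo : S → PMF (Option S)
  numNodes_init : ∀ x ∈ init.support, (tree x).numNodes = 1
  numNodes_growOne : ∀ x y, some y ∈ (growOne x).support →
    (tree y).numNodes = (tree x).numNodes + 1
  numNodes_growTwo : ∀ x y, some y ∈ (growTwo x).support →
    (tree y).numNodes = (tree x).numNodes + 2

namespace GrowthProcedure

variable {S : Type*} (G : GrowthProcedure S)

/-- A growth step: the increment is 1 with probability 2/3 and 2 with probability 1/3. -/
noncomputable def step (x : S) : PMF (Option S) :=
  (PMF.uniformOfFintype (Fin 3)).bind fun i => if i = 2 then G.growTwo x else G.growOne x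

/-- Grow (with at most the given number of steps) until the tree has at least `n` nodes or a step
fails. The result is the last tree that was built. -/
noncomputable def run (n : ℕ) : ℕ → S → PMF UBTree
  | 0, x => PMF.pure (G.tree x)
  | k + 1, x =>
    if n ≤ (G.tree x).numNodes then PMF.pure (G.tree x)
    else (G.step x).bind fun
      | none => PMF.pure (G.tree x)
      | some y => run n k y

/-- One trial with target size `n`: the law of the last tree that is built in it. Since each step
adds a node, the bound `n` on the number of steps is never in effect. The trial succeeds if this
tree has exactly `n` nodes. Otherwise it has fewer than `n` nodes (a growth step failed) or `n + 1`
nodes (the tree grew from `n - 1` to `n + 1` nodes), and the trial is rejected. -/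
noncomputable def trial (n : ℕ) : PMF UBTree := G.init.bind (G.run n n)

/-- The probability that the growth procedure reaches at least `n` nodes. -/
noncomputable def reachProb (n : ℕ) : ℝ :=
  (G.trial n).toMeasure.real {t | n ≤ t.numNodes}

/-- `T n i` is the last tree built in the `i`-th trial for the target size `n`: for each `n` the
trials are independent and distributed according to `G.trial n`. -/
structure IsTrialSequence {Ω : Type*} [MeasurableSpace Ω] (P : Measure Ω)
    (T : ℕ → ℕ → Ω → UBTree) : Prop where
  hasLaw : ∀ n i, HasLaw (T n i) (G.trial n).toMeasure P
  indep : ∀ n, iIndepFun (T n) P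

/-- The probability of reaching at least `n` nodes is equivalent to `c * n ^ (-1/2)` for some
constant `c > 0`. -/
def HasSquareRootSurvival : Prop :=
  ∃ c : ℝ, 0 < c ∧ G.reachProb ~[atTop] fun n : ℕ => c * (n : ℝ) ^ (-(1 / 2) : ℝ)

end GrowthProcedure

/-- The number of nodes built by the anticipated rejection algorithm with target size `n`, if the
successive trials end with the trees `t 0`, `t 1`, ...: the total number of nodes of the trees
built up to and including the first successful trial. -/
noncomputable def nodesBuilt (n : ℕ) (t : ℕ → UBTree) : ℕ :=
  ∑ i ∈ Finset.range (sInf {i | (t i).numNodes = n} + 1), (t i).numNodes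

/-! ### The grafting procedure

It interprets bijectively the equation
`(n + 1) * T n = (2 * n - 1) * T (n - 1) + 3 * (n - 2) * T (n - 2)` for the number `T n` of trees
with `n` nodes. Here `(n + 1) * T n` is the number of trees with `n` nodes that have a marked unary
node or a marked leaf in one of two colours: a tree with `u` unary nodes and `b` binary nodes has
`b + 1` leaves, so that `n + 1 = u + 2 * (b + 1)`. -/

/-- A tree with a mark: either a leaf is marked, in one of two colours, or a unary node is
marked. The marked node is given with its surroundings (and, for a unary node, its subtree). -/
inductive MarkedTree : Type
  | leaf (c : Context) (colour : Bool) : MarkedTree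
  | unary (c : Context) (child : UBTree) : MarkedTree

namespace MarkedTree

/-- The underlying tree. -/
def tree : MarkedTree → UBTree
  | leaf c _ => plug c UBTree.leaf
  | unary c t => plug c (UBTree.unary t)

/-- The node that the mark designates (the subtree rooted there, with its surroundings).
A marked unary node and a leaf marked in the colour `false` designate themselves; a leaf marked in
the colour `true` designates the closest binary ancestor in whose left subtree it lies. In this way
each node is designated by exactly one mark, and the remaining mark, namely the rightmost leaf in
the colour `true`, designates no node. -/
def node : MarkedTree → Option (Context × UBTree)
  | leaf c false => some (c, UBTree.leaf)
  | leaf c true => climb c UBTree.leaf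
  | unary c t => some (c, UBTree.unary t)

/-- Insert a unary node just above the given subtree, and mark it. -/
def insertUnary (q : Context × UBTree) : MarkedTree := unary q.1 q.2

/-- Graft a new leaf: insert a binary node just above the given subtree, whose other child is a new
leaf, on the left or on the right, and mark the new leaf in the given colour. -/
def graft (left colour : Bool) (q : Context × UBTree) : MarkedTree :=
  leaf ((if left then Frame.left q.2 else Frame.right q.2) :: q.1) colour

/-- Add a new leaf below the mark: a marked leaf becomes a unary node, whose child is the new leaf,
marked in the same colour; a marked unary node becomes a binary node, whose left child is the new
leaf, marked in the colour `true`. -/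
def extend : MarkedTree → MarkedTree
  | leaf c b => leaf (Frame.up :: c) b
  | unary c t => graft true true (c, t)

theorem numNodes_of_node {x : MarkedTree} {q : Context × UBTree} (h : x.node = some q) :
    x.tree.numNodes = contextNodes q.1 + q.2.numNodes := by
  rw [← numNodes_plug]
  cases x with
  | leaf c b =>
    cases b with
    | false => simp only [node, Option.some.injEq] at h; subst h; rfl
    | true => rw [plug_climb h]; rfl
  | unary c t => simp only [node, Option.some.injEq] at h; subst h; rfl

theorem numNodes_insertUnary (q : Context × UBTree) :
    (insertUnary q).tree.numNodes = contextNodes q.1 + q.2.numNodes + 1 := by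
  simp only [insertUnary, tree, numNodes_plug, UBTree.numNodes, Nat.add_assoc]

theorem numNodes_graft (l b : Bool) (q : Context × UBTree) :
    (graft l b q).tree.numNodes = contextNodes q.1 + q.2.numNodes + 2 := by
  cases l <;> simp [graft, tree, numNodes_plug, contextNodes, UBTree.numNodes]

theorem numNodes_extend (x : MarkedTree) : x.extend.tree.numNodes = x.tree.numNodes + 1 := by
  cases x with
  | leaf c b => simp only [extend, tree, numNodes_plug, contextNodes, UBTree.numNodes]
  | unary c t =>
    rw [extend, numNodes_graft]
    simp only [tree, numNodes_plug, UBTree.numNodes]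
    omega

/-- Growing by one node: with equal probabilities, insert a unary node above the designated node
(this fails if the mark designates no node), or add a new leaf below the mark. -/
def growOne (x : MarkedTree) : Bool → Option MarkedTree
  | false => x.node.map insertUnary
  | true => some x.extend

/-- Growing by two nodes: graft a new leaf above the designated node (this fails if the mark
designates no node); side and colour of the new leaf are one of the three possibilities that are
not used by `extend`, with equal probabilities. -/
def growTwo (x : MarkedTree) (i : Fin 3) : Option MarkedTree :=
  x.node.map (graft (i == 0) (i == 1))

end MarkedTree

/-- The grafting procedure. It starts with the tree with one node, marked in a random colour. -/
noncomputable def graftingProcedure : GrowthProcedure MarkedTree where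
  tree := MarkedTree.tree
  init := (PMF.uniformOfFintype Bool).map (MarkedTree.leaf [])
  growOne x := (PMF.uniformOfFintype Bool).map x.growOne
  growTwo x := (PMF.uniformOfFintype (Fin 3)).map x.growTwo
  numNodes_init x hx := by
    obtain ⟨b, -, rfl⟩ := (PMF.mem_support_map_iff _ _ _).1 hx
    rfl
  numNodes_growOne x y hy := by
    obtain ⟨b, -, hb⟩ := (PMF.mem_support_map_iff _ _ _).1 hy
    cases b with
    | false =>
      obtain ⟨q, hq, rfl⟩ := Option.map_eq_some_iff.1 hb
      rw [MarkedTree.numNodes_insertUnary, MarkedTree.numNodes_of_node hq]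
    | true =>
      obtain rfl := Option.some.inj hb
      exact MarkedTree.numNodes_extend x
  numNodes_growTwo x y hy := by
    obtain ⟨i, -, hi⟩ := (PMF.mem_support_map_iff _ _ _).1 hy
    obtain ⟨q, hq, rfl⟩ := Option.map_eq_some_iff.1 hi
    rw [MarkedTree.numNodes_graft, MarkedTree.numNodes_of_node hq]

/-! ### Darling--Mandelbrot distributions -/

/-- `μ` is the Darling--Mandelbrot distribution of parameter `α`: it is supported on the
nonnegative reals, and its characteristic function at `s` is
`(1 - ∑_{n ≥ 1} α / (n - α) * (i * s) ^ n / n!)⁻¹`. -/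
def IsDarlingMandelbrot (α : ℝ) (μ : ProbabilityMeasure ℝ) : Prop :=
  (μ : Measure ℝ) (Set.Iio 0) = 0 ∧
  ∀ s : ℝ, charFun (μ : Measure ℝ) s =
    (1 - ∑' n : ℕ, ((α : ℂ) / (((n + 1 : ℕ) : ℂ) - α)) *
      (Complex.I * s) ^ (n + 1) / ((n + 1).factorial : ℂ))⁻¹

/-- The law of the sum of `k` independent random variables of law `μ`. -/
noncomputable def convPower (μ : Measure ℝ) : ℕ → Measure ℝ
  | 0 => Measure.dirac 0
  | k + 1 => μ ∗ convPower μ k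

/-- `ν` is the distribution `D(α, p)`: the law of `Y₁ + ... + Y_Z` where the `Yᵢ` are distributed
like `1 + X` with `X` following the Darling--Mandelbrot distribution of parameter `α`, where `Z ≥ 1`
is geometrically distributed with success probability `p`, and where all these variables are
independent. -/
def IsDarlingMandelbrotSum (α p : ℝ) (ν : ProbabilityMeasure ℝ) : Prop :=
  ∃ μ : ProbabilityMeasure ℝ, IsDarlingMandelbrot α μ ∧
    (ν : Measure ℝ) = Measure.sum fun k : ℕ =>
      ENNReal.ofReal ((1 - p) ^ k * p) •
        convPower ((μ : Measure ℝ).map fun x => 1 + x) (k + 1)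

/-- `Y n / n` converges in distribution to `ν`; moreover `Y n` is square-integrable for all large
`n`, with `E(Y n) ~ (8/3) n` and `Var(Y n) ~ (32/9) n²`. -/
structure HasCostAsymptotics {Ω : Type*} [MeasurableSpace Ω] (P : Measure Ω)
    [IsProbabilityMeasure P] (Y : ℕ → Ω → ℝ) (ν : ProbabilityMeasure ℝ) : Prop where
  tendsto : TendstoInDistribution (fun (n : ℕ) ω => Y n ω / n) atTop id (fun _ => P)
    (ν : Measure ℝ)
  memLp : ∀ᶠ n in atTop, MemLp (Y n) 2 P
  mean : (fun n => ∫ ω, Y n ω ∂P) ~[atTop] fun n : ℕ => (8 / 3 : ℝ) * n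
  variance : (fun n => variance (Y n) P) ~[atTop] fun n : ℕ => (32 / 9 : ℝ) * (n : ℝ) ^ 2

/-! Let `p n`, `s n`, `d n` be the probabilities that a trial reaches size at least `n`, stops at
exactly `n`, or jumps to `n + 1`; thus `p n = s n + d n`. Overshooting `n + 1` means a non-failing
increment 2 from size `n`, so `d (n + 1)` equals `s n / 3` up to an error of at most `p n - p (n +
1)`. If `p n ~ c n ^ (-1/2)`, this error is negligible against `p n`, and `s n / p n` follows
asymptotically the contraction `x ↦ 1 - x / 3`; hence `s n / p n → 3/4` (`tendsto_success_ratio`).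
Among the trials that reach `n`, each costs about `n` and succeeds with probability about `3/4`:
this is the geometric variable in the limit law.

A trial ends at a size `m < n` with probability `p m - p (m + 1)`, whatever `n` is
(`trial_numNodes_eq_of_lt`). Put `z = exp (i s / n)`. Abel summation and the decay of `p` give `(1 -
∑_{m < n} (p m - p (m + 1)) z ^ m) / p n → H(s)`, where `H = halfSymbol` (`tendsto_one_sub_fail`),
and `1 / H` is the Darling–Mandelbrot transform for `α = 1/2` (`halfSymbol_eq`). Summing over the
index of the first success, the transform of the cost is `s n z ^ n / (1 - ∑ (p m - p (m + 1)) z ^ m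
- d n z ^ (n + 1))` (`integral_exp_nodesBuilt`). Dividing through by `p n`, it tends to `(3/4)
e^{is} / (H(s) - e^{is} / 4)`, the transform of the geometric sum, and Lévy's continuity theorem
applies. That a Darling–Mandelbrot law exists is obtained in the same way, as a limit of geometric
sums of failed trials.

The first two moments of the cost are rational expressions in `s n` and the moments of a single
trial (`moments_nodesBuilt`), which are asymptotic to `2 n p n` and `(4/3) n² p n`.

For the grafting procedure, each marked tree of size `n` is visited with the same probability `(3/2)
3 ^ (-n)`, because it has a single predecessor (`tsum_graftWeight_mul_step`). Since one of the `n +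
1` marks of a tree is stuck, `p` and `s` satisfy explicit recurrences, from which `n * p n ^ 2`
converges to a positive limit. -/

open scoped ENNReal

/-! ### First passage probabilities of a growth chain. -/

namespace GrowthProcedure

variable {S : Type*} (G : GrowthProcedure S)

theorem tsum_option_ennreal {α : Type*} (f : Option α → ℝ≥0∞) :
    ∑' a, f a = f none + ∑' a, f (some a) := by
  rw [← (Equiv.optionEquivSumPUnit.{0} α).symm.tsum_eq, ENNReal.summable.tsum_sum ENNReal.summable]
  simp [add_comm]

theorem step_apply (x : S) (z : Option S) :
    G.step x z = 2 / 3 * G.growOne x z + 1 / 3 * G.growTwo x z := by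
  simp only [step, PMF.bind_apply, PMF.uniformOfFintype_apply, Fintype.card_fin, tsum_fintype,
    Fin.sum_univ_three]
  simp only [Nat.cast_ofNat, Fin.isValue, Fin.reduceEq, ↓reduceIte, one_div, ENNReal.div_eq_inv_mul]
  ring

theorem numNodes_step {x z : S} (h : G.step x (some z) ≠ 0) :
    (G.tree z).numNodes = (G.tree x).numNodes + 1 ∨
      (G.tree z).numNodes = (G.tree x).numNodes + 2 := by
  by_contra! hc
  apply h
  have h1 : G.growOne x (some z) = 0 := by
    by_contra h1
    exact hc.1 (G.numNodes_growOne x z ((PMF.mem_support_iff _ _).2 h1))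
  have h2 : G.growTwo x (some z) = 0 := by
    by_contra h2
    exact hc.2 (G.numNodes_growTwo x z ((PMF.mem_support_iff _ _).2 h2))
  rw [step_apply, h1, h2]
  simp

/-- The expected value of `F` at the first state of size at least `n` that is reached from `x`
within `k` steps (with the value `0` if there is none). -/
noncomputable def hitValue (n : ℕ) (F : S → ℝ≥0∞) : ℕ → S → ℝ≥0∞
  | 0, x => if n ≤ (G.tree x).numNodes then F x else 0
  | k + 1, x => if n ≤ (G.tree x).numNodes then F x else
      ∑' z, G.step x (some z) * hitValue n F k z

/-- The expected value of `F` after one growth step. -/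
noncomputable def stepValue (F : S → ℝ≥0∞) (x : S) : ℝ≥0∞ := ∑' z, G.step x (some z) * F z

theorem hitValue_of_le {n : ℕ} {F : S → ℝ≥0∞} {x : S} (h : n ≤ (G.tree x).numNodes) (k : ℕ) :
    G.hitValue n F k x = F x := by
  cases k <;> simp [hitValue, h]

theorem tsum_step_congr {x : S} {F F' : S → ℝ≥0∞}
    (h : ∀ z, (G.tree x).numNodes + 1 ≤ (G.tree z).numNodes → F z = F' z) :
    ∑' z, G.step x (some z) * F z = ∑' z, G.step x (some z) * F' z := by
  refine tsum_congr fun z => ?_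
  by_cases hz : G.step x (some z) = 0
  · simp [hz]
  · rw [h z (by have := G.numNodes_step hz; omega)]

/-- A run that fails ends below size `n`, hence outside `A`, which agrees with the value `0` that
`hitValue` gives to failure. As each step adds a node, the bound on `k` ensures that the steps are
exhausted only at sizes at least `n`. -/
theorem run_apply (n k : ℕ) (x : S) (A : Set UBTree) (hk : n ≤ k + (G.tree x).numNodes)
    (hA : ∀ t ∈ A, n ≤ t.numNodes) :
    (G.run n k x).toOuterMeasure A = G.hitValue n (fun z => A.indicator 1 (G.tree z)) k x := by
  induction k generalizing x with
  | zero =>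
    rw [hitValue_of_le _ (by omega), run, PMF.toOuterMeasure_pure_apply]
    by_cases hx : G.tree x ∈ A <;> simp [hx]
  | succ k ih =>
    rw [run, hitValue]
    split_ifs with h
    · rw [PMF.toOuterMeasure_pure_apply]
      by_cases hx : G.tree x ∈ A <;> simp [hx]
    · rw [PMF.toOuterMeasure_bind_apply, tsum_option_ennreal]
      simp only [PMF.toOuterMeasure_pure_apply]
      rw [if_neg fun hx => h (hA _ hx), mul_zero, zero_add]
      exact G.tsum_step_congr fun z hz => ih z (by omega)

/-- Markov property at the first passage over `n`: the state there either already has size at least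
`n + 1`, or has size exactly `n`, and then one more step leads past `n + 1`. -/
theorem hitValue_succ (n k : ℕ) (F : S → ℝ≥0∞) (x : S) (hk : n ≤ k + (G.tree x).numNodes) :
    G.hitValue (n + 1) F (k + 1) x = G.hitValue n
      (fun y => if n + 1 ≤ (G.tree y).numNodes then F y else G.stepValue F y) k x := by
  induction k generalizing x with
  | zero =>
    rw [G.hitValue_of_le (n := n) (by omega), hitValue]
    split_ifs with h
    · rfl
    · exact G.tsum_step_congr fun z hz => G.hitValue_of_le (by omega) _
  | succ k ih =>
    rw [hitValue]
    by_cases h : n ≤ (G.tree x).numNodes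
    · rw [G.hitValue_of_le h]
      split_ifs with h'
      · rfl
      · exact G.tsum_step_congr fun z hz => G.hitValue_of_le (by omega) _
    · rw [if_neg (by omega), hitValue, if_neg h]
      exact G.tsum_step_congr fun z hz => ih z (by omega)

/-- The probability that `y` is the first state of size at least `n`. -/
noncomputable def hitMass : ℕ → S → ℝ≥0∞
  | 0, y => G.init y
  | n + 1, z => (if n + 1 ≤ (G.tree z).numNodes then hitMass n z else 0) +
      ∑' y, (if (G.tree y).numNodes ≤ n then hitMass n y * G.step y (some z) else 0)

theorem tsum_hitMass_succ (n : ℕ) (F : S → ℝ≥0∞) :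
    ∑' z, G.hitMass (n + 1) z * F z = ∑' y, G.hitMass n y *
      (if n + 1 ≤ (G.tree y).numNodes then F y else G.stepValue F y) := by
  simp only [hitMass, add_mul, ENNReal.tsum_add, ← ENNReal.tsum_mul_right]
  rw [ENNReal.tsum_comm, ← ENNReal.tsum_add]
  refine tsum_congr fun y => ?_
  split_ifs with h h'
  · omega
  · simp
  · simp only [stepValue, zero_mul, zero_add, ← ENNReal.tsum_mul_left, mul_assoc]
  · omega

/-- Duality of the backward recursion (`hitValue`) and the forward recursion (`hitMass`). -/
theorem tsum_init_mul_hitValue (n : ℕ) (F : S → ℝ≥0∞) :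
    ∑' x, G.init x * G.hitValue n F n x = ∑' y, G.hitMass n y * F y := by
  induction n generalizing F with
  | zero => simp [hitValue, hitMass]
  | succ n ih => 
    rw [tsum_hitMass_succ, ← ih]
    exact tsum_congr fun x => by rw [hitValue_succ _ _ _ _ _ (by omega)]

theorem trial_apply (n : ℕ) (A : Set UBTree) (hA : ∀ t ∈ A, n ≤ t.numNodes) :
    (G.trial n).toMeasure A = ∑' y, G.hitMass n y * A.indicator 1 (G.tree y) := by
  rw [PMF.toMeasure_apply_eq_toOuterMeasure_apply _ (MeasurableSpace.measurableSet_top),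
    trial, PMF.toOuterMeasure_bind_apply, ← tsum_init_mul_hitValue]
  exact tsum_congr fun x => by rw [run_apply _ _ _ _ _ (by omega) hA]

theorem numNodes_of_hitMass {n : ℕ} (hn : 1 ≤ n) {y : S} (hy : G.hitMass n y ≠ 0) :
    (G.tree y).numNodes = n ∨ (G.tree y).numNodes = n + 1 := by
  induction n, hn using Nat.le_induction generalizing y with
  | base =>
    left
    apply G.numNodes_init
    rw [PMF.mem_support_iff]
    contrapose! hy
    simp only [hitMass, hy, ite_self, zero_add, ENNReal.tsum_eq_zero]
    intro x
    split_ifs with hx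
    · by_contra h
      have := G.numNodes_init x ((PMF.mem_support_iff _ _).2 (left_ne_zero_of_mul h))
      omega
    · rfl
  | succ n hn ih =>
    by_contra hc
    apply hy
    rw [hitMass, add_eq_zero, ENNReal.tsum_eq_zero]
    constructor
    · split_ifs with h
      · by_contra h0
        have := ih h0
        omega
      · rfl
    · intro x
      split_ifs with hx
      · by_contra h0
        have h1 := ih (left_ne_zero_of_mul h0)
        have h2 := G.numNodes_step (right_ne_zero_of_mul h0)
        omega
      · rfl

/-- A run towards `n` reaches size `m ≤ n` with the same probability as a run towards `m`. -/
theorem run_reach {m n : ℕ} (hmn : m ≤ n) (k k' : ℕ) (x : S) (hk : n ≤ k + (G.tree x).numNodes)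
    (hk' : m ≤ k' + (G.tree x).numNodes) :
    (G.run n k x).toOuterMeasure {t | m ≤ t.numNodes} =
      (G.run m k' x).toOuterMeasure {t | m ≤ t.numNodes} := by
  -- Trees only grow: once size `m` is reached, the last tree has size at least `m` whatever happens
  -- later.
  have big : ∀ (n k : ℕ) (x : S), m ≤ (G.tree x).numNodes →
      (G.run n k x).toOuterMeasure {t | m ≤ t.numNodes} = 1 := by
    intro n k
    induction k with
    | zero => intro x hx; simp [run, PMF.toOuterMeasure_pure_apply, hx]
    | succ k ih =>
      intro x hx
      rw [run]
      split_ifs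
      · simp [PMF.toOuterMeasure_pure_apply, hx]
      · rw [PMF.toOuterMeasure_bind_apply, tsum_option_ennreal]
        simp only [PMF.toOuterMeasure_pure_apply, Set.mem_ofPred_eq, hx, if_true]
        rw [G.tsum_step_congr (F' := fun _ => 1) fun z hz => ih z (by omega)]
        simp only [mul_one]
        rw [← tsum_option_ennreal (fun a => G.step x a), PMF.tsum_coe]
  induction k' generalizing k x with
  | zero => rw [big _ _ _ (by omega), big _ _ _ (by omega)]
  | succ k' ih =>
    by_cases hx : m ≤ (G.tree x).numNodes
    · rw [big _ _ _ hx, big _ _ _ hx]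
    · obtain ⟨k, rfl⟩ : ∃ l, k = l + 1 := ⟨k - 1, by omega⟩
      rw [run, run, if_neg (by omega), if_neg (by omega), PMF.toOuterMeasure_bind_apply,
        PMF.toOuterMeasure_bind_apply, tsum_option_ennreal, tsum_option_ennreal]
      congr 1
      exact G.tsum_step_congr fun z hz => ih k z (by omega) (by omega)

theorem trial_reach {m n : ℕ} (hmn : m ≤ n) :
    (G.trial n).toMeasure.real {t | m ≤ t.numNodes} = G.reachProb m := by
  rw [reachProb, measureReal_def, measureReal_def,
    PMF.toMeasure_apply_eq_toOuterMeasure_apply _ (MeasurableSpace.measurableSet_top),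
    PMF.toMeasure_apply_eq_toOuterMeasure_apply _ (MeasurableSpace.measurableSet_top),
    trial, trial, PMF.toOuterMeasure_bind_apply, PMF.toOuterMeasure_bind_apply]
  congr 1
  exact tsum_congr fun x => by rw [G.run_reach hmn n m x (by omega) (by omega)]

/-- The probability that a trial with target size `n` succeeds. -/
noncomputable def successProb (n : ℕ) : ℝ := (G.trial n).toMeasure.real {t | t.numNodes = n}

/-- The probability that a trial grows from `n - 1` to `n + 1` nodes. -/
noncomputable def overshootProb (n : ℕ) : ℝ :=
  (G.trial n).toMeasure.real {t | n + 1 ≤ t.numNodes}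

theorem reachProb_eq (n : ℕ) : G.reachProb n = G.successProb n + G.overshootProb n := by
  rw [reachProb, successProb, overshootProb,
    ← measureReal_union _ (MeasurableSpace.measurableSet_top)]
  · congr 1
    ext t
    simp only [Set.mem_ofPred_eq, Set.mem_union]
    omega
  · exact Set.disjoint_left.2 fun t h h' => by simp only [Set.mem_ofPred_eq] at h h'; omega

theorem trial_overshoot {n : ℕ} (hn : 1 ≤ n) :
    (G.trial n).toMeasure {t | n + 2 ≤ t.numNodes} = 0 := by
  rw [trial_apply _ _ _ (fun t ht => by simp only [Set.mem_ofPred_eq] at ht; omega),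
    ENNReal.tsum_eq_zero]
  intro y
  by_cases hy : G.hitMass n y = 0
  · simp [hy]
  · have := G.numNodes_of_hitMass hn hy
    rw [Set.indicator_of_notMem (by simp only [Set.mem_ofPred_eq]; omega), mul_zero]

theorem stepValue_one_add (x : S) : G.stepValue 1 x + G.step x none = 1 := by
  rw [← (G.step x).tsum_coe, tsum_option_ennreal, add_comm]
  simp [stepValue]

/-- A gain of two nodes can only come from `growTwo`, which is selected with probability 1/3. -/
theorem stepValue_large (x : S) :
    G.stepValue (fun z => if (G.tree x).numNodes + 2 ≤ (G.tree z).numNodes then 1 else 0) x =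
      1 / 3 * ∑' z, G.growTwo x (some z) := by
  rw [stepValue, ← ENNReal.tsum_mul_left]
  refine tsum_congr fun z => ?_
  rw [step_apply]
  by_cases h1 : G.growOne x (some z) = 0
  · by_cases h2 : G.growTwo x (some z) = 0
    · simp [h1, h2]
    · have := G.numNodes_growTwo x z ((PMF.mem_support_iff _ _).2 h2)
      simp [h1, this]
  · have := G.numNodes_growOne x z ((PMF.mem_support_iff _ _).2 h1)
    have h2 : G.growTwo x (some z) = 0 := by
      by_contra h2
      have := G.numNodes_growTwo x z ((PMF.mem_support_iff _ _).2 h2)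
      omega
    simp [h2, this]

theorem successProb_eq_tsum (n : ℕ) : ENNReal.ofReal (G.successProb n) =
    ∑' y, G.hitMass n y * if (G.tree y).numNodes = n then 1 else 0 := by
  rw [successProb, ofReal_measureReal, trial_apply _ _ _ (fun t ht => ht.ge)]
  simp [Set.indicator_apply]

/-- The first state past `n` has size `n` or `n + 1`. In the second case size `n + 1` has been hit,
so an overshoot of `n + 1` starts at size exactly `n`. -/
theorem overshootProb_succ_eq_tsum {n : ℕ} (hn : 1 ≤ n) :
    ENNReal.ofReal (G.overshootProb (n + 1)) = ∑' y, G.hitMass n y *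
      if (G.tree y).numNodes = n then 1 / 3 * ∑' z, G.growTwo y (some z) else 0 := by
  rw [overshootProb, ofReal_measureReal, trial_apply _ _ _ (fun t ht => by
    simp only [Set.mem_ofPred_eq] at ht; omega), tsum_hitMass_succ]
  refine tsum_congr fun y => ?_
  by_cases hy : G.hitMass n y = 0
  · simp [hy]
  · congr 1
    rcases G.numNodes_of_hitMass hn hy with h | h
    · rw [if_neg (by omega), if_pos h, ← stepValue_large]
      simp [Set.indicator_apply, h, Nat.succ_le_iff]
    · rw [if_pos (by omega), if_neg (by omega), Set.indicator_of_notMem]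
      simp only [Set.mem_ofPred_eq]; omega

theorem reachProb_eq_tsum (n : ℕ) (hn : 1 ≤ n) :
    ENNReal.ofReal (G.reachProb n) = ∑' y, G.hitMass n y := by
  rw [reachProb, ofReal_measureReal, trial_apply _ _ {t | n ≤ t.numNodes} (fun t ht => ht)]
  refine tsum_congr fun y => ?_
  by_cases hy : G.hitMass n y = 0
  · simp [hy]
  · have := G.numNodes_of_hitMass hn hy
    rw [Set.indicator_of_mem (by simp only [Set.mem_ofPred_eq]; omega)]
    simp

theorem reachProb_nonneg (n : ℕ) : 0 ≤ G.reachProb n := measureReal_nonneg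
theorem successProb_nonneg (n : ℕ) : 0 ≤ G.successProb n := measureReal_nonneg
theorem overshootProb_nonneg (n : ℕ) : 0 ≤ G.overshootProb n := measureReal_nonneg

/-- Survival past `n` is lost only by a failure at size exactly `n`, since a first passage at `n +
1` already counts for both sizes. -/
theorem reachProb_eq_succ_add {n : ℕ} (hn : 1 ≤ n) :
    ENNReal.ofReal (G.reachProb n) = ENNReal.ofReal (G.reachProb (n + 1)) + ∑' y, G.hitMass n y *
      if (G.tree y).numNodes = n then G.step y none else 0 := by
  have h := G.tsum_hitMass_succ n 1
  simp only [Pi.one_apply, mul_one] at h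
  rw [reachProb_eq_tsum _ _ hn, reachProb_eq_tsum _ _ (by omega), h, ← ENNReal.tsum_add]
  refine tsum_congr fun y => ?_
  by_cases hy : G.hitMass n y = 0
  · simp [hy]
  · rcases G.numNodes_of_hitMass hn hy with h | h
    · rw [if_neg (by omega), if_pos h, ← mul_add, stepValue_one_add, mul_one]
    · rw [if_pos (by omega), if_neg (by omega)]
      simp

theorem reachProb_of_le_one {n : ℕ} (hn : n ≤ 1) : G.reachProb n = 1 := by
  have h : {t : UBTree | n ≤ t.numNodes} = Set.univ := by
    ext t
    cases t <;> simp only [UBTree.numNodes, Set.mem_ofPred_eq, Set.mem_univ, iff_true] <;> omega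
  rw [reachProb, h, probReal_univ]

theorem overshootProb_succ_le {n : ℕ} (hn : 1 ≤ n) :
    G.overshootProb (n + 1) ≤ 1 / 3 * G.successProb n := by
  have h3 : ENNReal.ofReal (1 / 3) = 1 / 3 := by
    rw [ENNReal.ofReal_div_of_pos (by norm_num)]; simp
  rw [← ENNReal.ofReal_le_ofReal_iff (mul_nonneg (by norm_num) (G.successProb_nonneg n)),
    overshootProb_succ_eq_tsum _ hn, ENNReal.ofReal_mul (by norm_num), successProb_eq_tsum, h3,
    ← ENNReal.tsum_mul_left]
  refine ENNReal.tsum_le_tsum fun y => ?_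
  rw [mul_left_comm]
  gcongr
  split_ifs
  · gcongr
    rw [← (G.growTwo y).tsum_coe, tsum_option_ennreal]
    exact le_add_self
  · simp

/-- From size `n`, an increment 2 is drawn with probability 1/3 and then either overshoots `n + 1`
or fails; the failures at size `n` have total probability `p n - p (n + 1)`. -/
theorem successProb_le_overshootProb {n : ℕ} (hn : 1 ≤ n) :
    1 / 3 * G.successProb n ≤
      G.overshootProb (n + 1) + (G.reachProb n - G.reachProb (n + 1)) := by
  have h3 : ENNReal.ofReal (1 / 3) = 1 / 3 := by
    rw [ENNReal.ofReal_div_of_pos (by norm_num)]; simp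
  suffices h : 1 / 3 * G.successProb n + G.reachProb (n + 1) ≤
      G.overshootProb (n + 1) + G.reachProb n by linarith
  have h0 := G.successProb_nonneg n
  rw [← ENNReal.ofReal_le_ofReal_iff (add_nonneg (G.overshootProb_nonneg _)
      (G.reachProb_nonneg _)), ENNReal.ofReal_add (by positivity) (G.reachProb_nonneg _),
    ENNReal.ofReal_add (G.overshootProb_nonneg _) (G.reachProb_nonneg _),
    reachProb_eq_succ_add _ hn, add_left_comm, add_comm]
  gcongr
  rw [overshootProb_succ_eq_tsum _ hn, ENNReal.ofReal_mul (by norm_num), successProb_eq_tsum, h3,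
    ← ENNReal.tsum_mul_left, ← ENNReal.tsum_add]
  refine ENNReal.tsum_le_tsum fun y => ?_
  rw [mul_left_comm, ← mul_add]
  gcongr
  split_ifs
  · have h : ∑' z, G.growTwo y (some z) + G.growTwo y none = 1 := by
      rw [← (G.growTwo y).tsum_coe, tsum_option_ennreal, add_comm]
    rw [← mul_one (1 / 3), ← h, mul_add, step_apply, h, mul_one]
    exact add_le_add le_rfl le_add_self
  · simp

end GrowthProcedure

/-! ### Counting marks and inverting the designation of nodes. -/

namespace UBTree

/-- The surroundings of the rightmost leaf of the subtree `t` with surroundings `c`. -/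
def rightEnd : Context → UBTree → Context
  | c, leaf => c
  | c, unary t => rightEnd (Frame.up :: c) t
  | c, binary l r => rightEnd (Frame.right l :: c) r

theorem climb_rightEnd (c : Context) (t : UBTree) : climb (rightEnd c t) leaf = climb c t := by
  induction t generalizing c with
  | leaf => rfl
  | unary t ih => rw [rightEnd, ih, climb]
  | binary l r _ ih => rw [rightEnd, ih, climb]

/-- Inverts `climb`: a climb that stops at a binary node started on the right spine of its left
subtree, so both have the same rightmost leaf. -/
theorem climb_eq_some {c c' : Context} {t u : UBTree} (h : climb c t = some (c', u)) :
    ∃ l r, u = binary l r ∧ rightEnd c t = rightEnd (Frame.left r :: c') l := by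
  induction c generalizing t with
  | nil => simp [climb] at h
  | cons f c ih =>
    cases f with
    | up => exact ih h
    | right l => exact ih h
    | left r =>
      simp only [climb, Option.some.injEq, Prod.mk.injEq] at h
      obtain ⟨rfl, rfl⟩ := h
      exact ⟨t, r, rfl, rfl⟩

theorem climb_append (f : Frame) (c : Context) (t : UBTree) :
    climb (c ++ [f]) t = match climb c t with
      | some q => some (q.1 ++ [f], q.2)
      | none => climb [f] (plug c t) := by
  induction c generalizing t with
  | nil => simp [climb, plug]
  | cons g c ih => cases g <;> simp [climb, plug, ih]

theorem plug_append (f : Frame) (c : Context) (t : UBTree) :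
    plug (c ++ [f]) t = plug [f] (plug c t) := by
  induction c generalizing t with
  | nil => rfl
  | cons g c ih => cases g <;> simp [plug, ih]

end UBTree

namespace MarkedTree

/-- The mark that designates a given node. -/
def ofNode : Context → UBTree → MarkedTree
  | c, UBTree.leaf => leaf c false
  | c, UBTree.unary t => unary c t
  | c, UBTree.binary l r => leaf (rightEnd (Frame.left r :: c) l) true

theorem node_eq_some {x : MarkedTree} {c : Context} {t : UBTree} :
    x.node = some (c, t) ↔ x = ofNode c t := by
  constructor
  · intro h
    cases x with
    | unary c' t' =>
      simp only [node, Option.some.injEq, Prod.mk.injEq] at h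
      obtain ⟨rfl, rfl⟩ := h
      rfl
    | leaf c' b =>
      cases b with
      | false =>
        simp only [node, Option.some.injEq, Prod.mk.injEq] at h
        obtain ⟨rfl, rfl⟩ := h
        rfl
      | true =>
        obtain ⟨l, r, rfl, hc⟩ := climb_eq_some h
        rw [ofNode, ← hc, rightEnd]
  · rintro rfl
    cases t with
    | leaf => rfl
    | unary t => rfl
    | binary l r => rw [ofNode, node, climb_rightEnd, climb]

/-- Put a marked tree below a further parent of its root. -/
def push (f : Frame) : MarkedTree → MarkedTree
  | leaf c b => leaf (c ++ [f]) b
  | unary c t => unary (c ++ [f]) t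

theorem push_injective (f : Frame) : Function.Injective (push f) := by
  intro x y h
  cases x <;> cases y <;> simp_all [push]

theorem tree_push (f : Frame) (x : MarkedTree) : (x.push f).tree = plug [f] x.tree := by
  cases x <;> simp only [push, tree, plug_append]

/-- Contexts are listed from the node upwards, so the frame below the root comes last. Splitting it
off reduces a marked tree to a marked subtree of the root, which makes induction on the tree
possible. -/
theorem eq_push_or (x : MarkedTree) : (∃ f y, x = push f y) ∨
    (∃ b, x = leaf [] b) ∨ ∃ t, x = unary [] t := by
  cases x with
  | leaf c b =>
    rcases c.eq_nil_or_concat with rfl | ⟨c, f, rfl⟩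
    · exact Or.inr (Or.inl ⟨b, rfl⟩)
    · exact Or.inl ⟨f, leaf c b, by simp [push]⟩
  | unary c t =>
    rcases c.eq_nil_or_concat with rfl | ⟨c, f, rfl⟩
    · exact Or.inr (Or.inr ⟨t, rfl⟩)
    · exact Or.inl ⟨f, unary c t, by simp [push]⟩

/-- A new root can rescue a failed climb only if the old tree becomes its left child. -/
theorem node_push_eq_none (f : Frame) (x : MarkedTree) :
    (x.push f).node = none ↔ x.node = none ∧ climb [f] x.tree = none := by
  cases x with
  | unary c t => simp [push, node]
  | leaf c b =>
    cases b with
    | false => simp [push, node]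
    | true =>
      simp only [push, node, tree, climb_append]
      cases climb c UBTree.leaf <;> simp

theorem setOf_tree_eq_leaf : {x : MarkedTree | x.tree = UBTree.leaf} =
    {leaf [] false, leaf [] true} := by
  ext x
  simp only [Set.mem_ofPred_eq, Set.mem_insert_iff, Set.mem_singleton_iff]
  constructor
  · intro h
    rcases x.eq_push_or with ⟨f, y, rfl⟩ | ⟨b, rfl⟩ | ⟨t, rfl⟩
    · rw [tree_push] at h; cases f <;> simp [plug] at h
    · cases b <;> simp
    · simp [tree, plug] at h
  · rintro (rfl | rfl) <;> rfl

theorem setOf_tree_eq_unary (t : UBTree) : {x : MarkedTree | x.tree = UBTree.unary t} =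
    insert (unary [] t) (push Frame.up '' {x | x.tree = t}) := by
  ext x
  simp only [Set.mem_ofPred_eq, Set.mem_insert_iff, Set.mem_image]
  constructor
  · intro h
    rcases x.eq_push_or with ⟨f, y, rfl⟩ | ⟨b, rfl⟩ | ⟨t, rfl⟩
    · rw [tree_push] at h
      cases f <;> simp [plug] at h
      exact Or.inr ⟨y, h, rfl⟩
    · simp [tree, plug] at h
    · simp only [tree, plug, UBTree.unary.injEq] at h
      simp [h]
  · rintro (rfl | ⟨y, rfl, rfl⟩)
    · rfl
    · rw [tree_push]; rfl

theorem setOf_tree_eq_binary (l r : UBTree) : {x : MarkedTree | x.tree = UBTree.binary l r} =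
    push (Frame.left r) '' {x | x.tree = l} ∪ push (Frame.right l) '' {x | x.tree = r} := by
  ext x
  simp only [Set.mem_ofPred_eq, Set.mem_union, Set.mem_image]
  constructor
  · intro h
    rcases x.eq_push_or with ⟨f, y, rfl⟩ | ⟨b, rfl⟩ | ⟨t, rfl⟩
    · rw [tree_push] at h
      cases f <;> simp [plug] at h
      · obtain ⟨h, rfl⟩ := h
        exact Or.inl ⟨y, h, rfl⟩
      · obtain ⟨rfl, h⟩ := h
        exact Or.inr ⟨y, h, rfl⟩
    · simp [tree, plug] at h
    · simp [tree, plug] at h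
  · rintro (⟨y, rfl, rfl⟩ | ⟨y, rfl, rfl⟩) <;> rw [tree_push] <;> rfl

theorem push_ne_push {f g : Frame} (h : f ≠ g) (x y : MarkedTree) : x.push f ≠ y.push g := by
  cases x <;> cases y <;> simp [push, h]

/-- A tree of size `m` has `m + 1` marks. -/
theorem encard_setOf_tree_eq (t : UBTree) :
    {x : MarkedTree | x.tree = t}.encard = t.numNodes + 1 := by
  induction t with
  | leaf =>
    rw [setOf_tree_eq_leaf, Set.encard_pair (by simp)]
    norm_num [numNodes]
  | unary t ih =>
    rw [setOf_tree_eq_unary, Set.encard_insert_of_notMem,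
      (push_injective _).encard_image, ih]
    · simp [numNodes]
    · rintro ⟨y, -, h⟩
      cases y <;> simp [push] at h
  | binary l r ihl ihr =>
    rw [setOf_tree_eq_binary, Set.encard_union_eq, (push_injective _).encard_image,
      (push_injective _).encard_image, ihl, ihr]
    · simp only [numNodes]; push_cast; ring
    · rw [Set.disjoint_left]
      rintro _ ⟨x, -, rfl⟩ ⟨y, -, h⟩
      exact push_ne_push (by simp) _ _ h

/-- Exactly one mark designates no node. -/
theorem encard_setOf_node_eq_none (t : UBTree) :
    {x : MarkedTree | x.tree = t ∧ x.node = none}.encard = 1 := by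
  induction t with
  | leaf =>
    have h : {x : MarkedTree | x.tree = UBTree.leaf ∧ x.node = none} = {leaf [] true} := by
      change {x : MarkedTree | x.tree = UBTree.leaf} ∩ {x | x.node = none} = _
      rw [setOf_tree_eq_leaf]
      ext x
      simp only [Set.mem_inter_iff, Set.mem_insert_iff, Set.mem_singleton_iff, Set.mem_ofPred_eq]
      constructor
      · rintro ⟨rfl | rfl, h⟩
        · simp [node] at h
        · rfl
      · rintro rfl
        exact ⟨Or.inr rfl, rfl⟩
    rw [h, Set.encard_singleton]
  | unary t ih =>
    have h : {x : MarkedTree | x.tree = UBTree.unary t ∧ x.node = none} =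
        push Frame.up '' {x | x.tree = t ∧ x.node = none} := by
      change {x : MarkedTree | x.tree = UBTree.unary t} ∩ {x | x.node = none} = _
      rw [setOf_tree_eq_unary]
      ext x
      simp only [Set.mem_inter_iff, Set.mem_insert_iff, Set.mem_image, Set.mem_ofPred_eq]
      constructor
      · rintro ⟨rfl | ⟨y, rfl, rfl⟩, h⟩
        · simp [node] at h
        · exact ⟨y, ⟨rfl, ((node_push_eq_none _ _).1 h).1⟩, rfl⟩
      · rintro ⟨y, ⟨rfl, h⟩, rfl⟩
        exact ⟨Or.inr ⟨y, rfl, rfl⟩, (node_push_eq_none _ _).2 ⟨h, rfl⟩⟩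
    rw [h, (push_injective _).encard_image, ih]
  | binary l r _ ih =>
    have h : {x : MarkedTree | x.tree = UBTree.binary l r ∧ x.node = none} =
        push (Frame.right l) '' {x | x.tree = r ∧ x.node = none} := by
      change {x : MarkedTree | x.tree = UBTree.binary l r} ∩ {x | x.node = none} = _
      rw [setOf_tree_eq_binary]
      ext x
      simp only [Set.mem_inter_iff, Set.mem_union, Set.mem_image, Set.mem_ofPred_eq]
      constructor
      · rintro ⟨⟨y, rfl, rfl⟩ | ⟨y, rfl, rfl⟩, h⟩
        · simpa [climb] using ((node_push_eq_none _ _).1 h).2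
        · exact ⟨y, ⟨rfl, ((node_push_eq_none _ _).1 h).1⟩, rfl⟩
      · rintro ⟨y, ⟨rfl, h⟩, rfl⟩
        exact ⟨Or.inr ⟨y, rfl, rfl⟩, (node_push_eq_none _ _).2 ⟨h, rfl⟩⟩
    rw [h, (push_injective _).encard_image, ih]

end MarkedTree

/-! ### The grafting chain: predecessors, uniformity and recurrences. -/

namespace MarkedTree

theorem growOne_false_eq_some {y z : MarkedTree} :
    y.growOne false = some z ↔ ∃ c t, z = unary c t ∧ y = ofNode c t := by
  rw [growOne, Option.map_eq_some_iff]
  constructor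
  · rintro ⟨⟨c, t⟩, h, rfl⟩
    exact ⟨c, t, rfl, node_eq_some.1 h⟩
  · rintro ⟨c, t, rfl, h⟩
    exact ⟨⟨c, t⟩, node_eq_some.2 h, rfl⟩

theorem growTwo_eq_some {y z : MarkedTree} {i : Fin 3} :
    y.growTwo i = some z ↔ ∃ c t, z = graft (i == 0) (i == 1) (c, t) ∧ y = ofNode c t := by
  rw [growTwo, Option.map_eq_some_iff]
  constructor
  · rintro ⟨⟨c, t⟩, h, rfl⟩
    exact ⟨c, t, rfl, node_eq_some.1 h⟩
  · rintro ⟨c, t, rfl, h⟩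
    exact ⟨⟨c, t⟩, node_eq_some.2 h, rfl⟩

theorem extend_eq_leaf_up {y : MarkedTree} {c : Context} {b : Bool} :
    y.extend = leaf (Frame.up :: c) b ↔ y = leaf c b := by
  cases y <;> simp [extend, graft]

theorem extend_eq_leaf_left {y : MarkedTree} {c : Context} {r : UBTree} {b : Bool} :
    y.extend = leaf (Frame.left r :: c) b ↔ b = true ∧ y = unary c r := by
  cases y <;> simp [extend, graft]
  tauto

theorem extend_ne_leaf_right {y : MarkedTree} {c : Context} {l : UBTree} {b : Bool} :
    y.extend ≠ leaf (Frame.right l :: c) b := by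
  cases y <;> simp [extend, graft]

theorem extend_ne_unary {y : MarkedTree} {c : Context} {t : UBTree} :
    y.extend ≠ unary c t := by
  cases y <;> simp [extend, graft]

end MarkedTree

open MarkedTree GrowthProcedure

open scoped Classical in
-- Each of the two one-node moves has probability `2/3 * 1/2 = 1/3`, each of the three two-node
-- moves `1/3 * 1/3 = 1/9`.
theorem graftingProcedure_step_some (y z : MarkedTree) :
    graftingProcedure.step y (some z) =
      (3⁻¹ * (if y.growOne false = some z then 1 else 0) + 3⁻¹ * (if y.extend = z then 1 else 0)) +
      9⁻¹ * ((if y.growTwo 0 = some z then 1 else 0) + (if y.growTwo 1 = some z then 1 else 0) +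
        (if y.growTwo 2 = some z then 1 else 0)) := by
  have h2 : (2 / 3 : ℝ≥0∞) * 2⁻¹ = 3⁻¹ := by
    rw [div_eq_mul_inv, mul_right_comm, ENNReal.mul_inv_cancel (by simp) (by simp), one_mul]
  have h3 : (1 / 3 : ℝ≥0∞) * 3⁻¹ = 9⁻¹ := by
    rw [one_div, ← ENNReal.mul_inv (by simp) (by simp)]; norm_num
  have h4 : y.growOne true = some z ↔ y.extend = z := by rw [MarkedTree.growOne, Option.some.injEq]
  rw [step_apply]
  simp only [graftingProcedure, PMF.map_apply, PMF.uniformOfFintype_apply, tsum_fintype,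
    Fintype.sum_bool, Fin.sum_univ_three, Fintype.card_bool, Fintype.card_fin, Nat.cast_ofNat,
    eq_comm (a := some z), h4, ← mul_boole _ (2⁻¹ : ℝ≥0∞), ← mul_boole _ (3⁻¹ : ℝ≥0∞)]
  rw [← mul_add, ← mul_add, ← mul_add, ← mul_assoc, ← mul_assoc, h2, h3, ← mul_add, add_comm (ite _ _ _)]

theorem graftingProcedure_growTwo_none (y : MarkedTree) :
    graftingProcedure.growTwo y none = if y.node = none then 1 else 0 := by
  have h3 : (3 : ℝ≥0∞)⁻¹ + 3⁻¹ + 3⁻¹ = 1 := ENNReal.inv_three_add_inv_three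
  have h : ∀ i, none = y.growTwo i ↔ y.node = none := fun i => by
    rw [eq_comm, MarkedTree.growTwo, Option.map_eq_none_iff]
  simp only [graftingProcedure, PMF.map_apply, PMF.uniformOfFintype_apply, tsum_fintype,
    Fin.sum_univ_three, Fintype.card_fin, Nat.cast_ofNat, h]
  split_ifs <;> simp [h3]

/-- When the mark is stuck, only `extend` (probability 1/3) is possible. -/
theorem graftingProcedure_step_none (y : MarkedTree) :
    graftingProcedure.step y none = if y.node = none then 2 / 3 else 0 := by
  rw [step_apply, graftingProcedure_growTwo_none]
  have h2 : (2 / 3 : ℝ≥0∞) * 2⁻¹ = 1 / 3 := by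
    rw [div_eq_mul_inv, mul_right_comm, ENNReal.mul_inv_cancel (by simp) (by simp), one_div, one_mul]
  have h : none = y.growOne false ↔ y.node = none := by
    rw [eq_comm, MarkedTree.growOne, Option.map_eq_none_iff]
  have h' : ¬ none = y.growOne true := by simp [MarkedTree.growOne]
  simp only [graftingProcedure, PMF.map_apply, PMF.uniformOfFintype_apply, tsum_fintype,
    Fintype.sum_bool, Fintype.card_bool, Nat.cast_ofNat, h, h', if_false, zero_add]
  split_ifs
  · rw [h2, mul_one, ENNReal.div_add_div_same, one_add_one_eq_two]
  · simp

theorem tsum_growTwo_graftingProcedure (y : MarkedTree) :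
    ∑' z, graftingProcedure.growTwo y (some z) = if y.node = none then 0 else 1 := by
  have h1 := (graftingProcedure.growTwo y).tsum_coe
  rw [tsum_option_ennreal, graftingProcedure_growTwo_none] at h1
  split_ifs with h
  · rw [if_pos h] at h1
    exact (ENNReal.add_right_inj ENNReal.one_ne_top).1 (h1.trans (add_zero 1).symm)
  · rwa [if_neg h, zero_add] at h1

/-- The probability that a given marked tree of size `n` is built. -/
noncomputable def graftWeight (n : ℕ) : ℝ≥0∞ := 3 / 2 * 3⁻¹ ^ n

/-- Every marked tree with at least two nodes arises from exactly one state by exactly one move,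
which can be read off the mark. A marked unary node was inserted. A marked leaf below a unary node,
or a left leaf of colour `true`, comes from `extend`; the three other positions and colours of a
leaf below a binary node come from the three kinds of `graft`. The move contributes a factor 1/3 per
added node, so a weight proportional to `3 ^ (-n)` is preserved. -/
theorem tsum_graftWeight_mul_step (z : MarkedTree) (hz : 2 ≤ z.tree.numNodes) :
    ∑' y, graftWeight y.tree.numNodes * graftingProcedure.step y (some z) =
      graftWeight z.tree.numNodes := by
  classical
  have one : ∀ x, (∀ y, graftingProcedure.step y (some z) = if y = x then 3⁻¹ else 0) →
      z.tree.numNodes = x.tree.numNodes + 1 →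
      ∑' y, graftWeight y.tree.numNodes * graftingProcedure.step y (some z) =
        graftWeight z.tree.numNodes := by
    intro x hx hn
    rw [tsum_eq_single x (fun y hy => by rw [hx, if_neg hy, mul_zero]), hx, if_pos rfl, hn,
      graftWeight, graftWeight, pow_succ, mul_assoc]
  have two : ∀ x, (∀ y, graftingProcedure.step y (some z) = if y = x then 9⁻¹ else 0) →
      z.tree.numNodes = x.tree.numNodes + 2 →
      ∑' y, graftWeight y.tree.numNodes * graftingProcedure.step y (some z) =
        graftWeight z.tree.numNodes := by
    intro x hx hn
    have h9 : (9 : ℝ≥0∞)⁻¹ = 3⁻¹ ^ 2 := by rw [← ENNReal.inv_pow]; norm_num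
    rw [tsum_eq_single x (fun y hy => by rw [hx, if_neg hy, mul_zero]), hx, if_pos rfl, hn,
      graftWeight, graftWeight, pow_add, mul_assoc, h9]
  have hnode : ∀ c t, (ofNode c t).tree.numNodes = contextNodes c + t.numNodes := fun c t =>
    numNodes_of_node (node_eq_some.2 rfl)
  cases z with
  | unary c t =>
    refine one (ofNode c t) (fun y => ?_) ?_
    · simp only [graftingProcedure_step_some, growOne_false_eq_some, growTwo_eq_some, graft,
        extend_ne_unary]
      by_cases h : y = ofNode c t
      · simp [h]
      · simp [h]
    · rw [hnode, ← numNodes_insertUnary (c, t)]; rfl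
  | leaf c b =>
    cases c with
    | nil => simp [MarkedTree.tree, plug, numNodes] at hz
    | cons f c =>
      cases f with
      | up =>
        refine one (leaf c b) (fun y => ?_) ?_
        · simp only [graftingProcedure_step_some, growOne_false_eq_some, growTwo_eq_some, graft,
            extend_eq_leaf_up]
          by_cases h : y = leaf c b <;> simp [h]
        · rw [← numNodes_extend]; rfl
      | left r =>
        cases b with
        | true =>
          refine one (unary c r) (fun y => ?_) ?_
          · simp only [graftingProcedure_step_some, growOne_false_eq_some, growTwo_eq_some, graft,
              extend_eq_leaf_left]
            by_cases h : y = unary c r <;> simp [h]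
          · rw [← numNodes_extend]; rfl
        | false =>
          refine two (ofNode c r) (fun y => ?_) ?_
          · simp only [graftingProcedure_step_some, growOne_false_eq_some, growTwo_eq_some, graft,
              extend_eq_leaf_left]
            by_cases h : y = ofNode c r <;> simp [h]
          · rw [hnode, ← numNodes_graft true false (c, r)]; rfl
      | right l =>
        refine two (ofNode c l) (fun y => ?_) ?_
        · simp only [graftingProcedure_step_some, growOne_false_eq_some, growTwo_eq_some, graft,
            extend_ne_leaf_right]
          by_cases h : y = ofNode c l <;> cases b <;> simp [h]
        · rw [hnode, ← numNodes_graft false b (c, l)]; rfl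

theorem numNodes_pos (t : UBTree) : 1 ≤ t.numNodes := by cases t <;> simp [numNodes]

theorem graftingProcedure_init (z : MarkedTree) :
    graftingProcedure.init z = if z.tree.numNodes = 1 then graftWeight 1 else 0 := by
  -- The factor `3/2` in `graftWeight` makes the weight at size 1 equal to the initial probability
  -- 1/2 of each colour.
  have hw : graftWeight 1 = 2⁻¹ := by
    rw [graftWeight, pow_one, div_eq_mul_inv, mul_right_comm,
      ENNReal.mul_inv_cancel (by simp) (by simp), one_mul]
  split_ifs with h
  · have hz : ∃ b, z = leaf [] b := by
      cases z with
      | unary c t =>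
        have := numNodes_pos t
        simp only [MarkedTree.tree, numNodes_plug, numNodes] at h
        omega
      | leaf c b =>
        cases c with
        | nil => exact ⟨b, rfl⟩
        | cons f c =>
          cases f <;> simp only [MarkedTree.tree, numNodes_plug, numNodes, contextNodes] at h <;> omega
    obtain ⟨b, rfl⟩ := hz
    simp only [graftingProcedure, PMF.map_apply, PMF.uniformOfFintype_apply, tsum_fintype,
      Fintype.sum_bool, Fintype.card_bool, hw]
    cases b <;> simp
  · by_contra h0
    exact h (graftingProcedure.numNodes_init z ((PMF.mem_support_iff _ _).2 h0))

/-- The two claims must be proved together. A state of size `n + 1` at the passage over `n` has only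
received the mass of jumps from size `n - 1`; at the next passage the one-node steps from size `n`
are added, and the two parts together make up the full weight. -/
theorem hitMass_graftingProcedure_aux {n : ℕ} (hn : 1 ≤ n) :
    (∀ y, y.tree.numNodes = n → graftingProcedure.hitMass n y = graftWeight n) ∧
    ∀ z, z.tree.numNodes = n + 1 → graftingProcedure.hitMass n z =
      ∑' y, if y.tree.numNodes + 1 = n then
        graftWeight y.tree.numNodes * graftingProcedure.step y (some z) else 0 := by
  have htree : graftingProcedure.tree = MarkedTree.tree := rfl
  induction n, hn using Nat.le_induction with
  | base =>
    have h0 : ∀ z, (∑' y, if (graftingProcedure.tree y).numNodes ≤ 0 then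
        graftingProcedure.hitMass 0 y * graftingProcedure.step y (some z) else 0) = 0 := by
      intro z
      rw [ENNReal.tsum_eq_zero]
      intro y
      have := numNodes_pos (graftingProcedure.tree y)
      rw [if_neg (by omega)]
    constructor
    · intro y hy
      rw [hitMass, h0, hitMass, graftingProcedure_init, htree, hy]
      simp
    · intro z hz
      rw [hitMass, h0, hitMass, graftingProcedure_init, htree, hz]
      simp only [Nat.reduceAdd, Nat.reduceLeDiff, if_true, OfNat.ofNat_ne_one, if_false, add_zero]
      symm
      rw [ENNReal.tsum_eq_zero]
      intro y
      have := numNodes_pos y.tree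
      rw [if_neg (by omega)]
  | succ n hn ih =>
    have h1 : ∀ z, (∑' y, if (graftingProcedure.tree y).numNodes ≤ n then
        graftingProcedure.hitMass n y * graftingProcedure.step y (some z) else 0) =
        ∑' y, if y.tree.numNodes + 1 = n + 1 then
          graftWeight y.tree.numNodes * graftingProcedure.step y (some z) else 0 := by
      intro z
      refine tsum_congr fun y => ?_
      by_cases hy : graftingProcedure.hitMass n y = 0
      · split_ifs with h h' h'
        · rw [show y.tree.numNodes = n by omega, ← ih.1 y (by omega), hy, zero_mul]
        · simp [hy]
        · have : (graftingProcedure.tree y).numNodes = y.tree.numNodes := rfl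
          omega
        · rfl
      · have := graftingProcedure.numNodes_of_hitMass hn hy
        rw [htree] at this ⊢
        split_ifs with h h' h'
        · rw [ih.1 y (by omega), show y.tree.numNodes = n by omega]
        · omega
        · omega
        · rfl
    constructor
    · intro z hz
      rw [hitMass, h1, ih.2 z hz, htree, if_pos (by omega), ← ENNReal.tsum_add, ← hz,
        ← tsum_graftWeight_mul_step z (by omega)]
      refine tsum_congr fun y => ?_
      by_cases hy : graftingProcedure.step y (some z) = 0
      · simp [hy]
      · have := graftingProcedure.numNodes_step hy
        rw [htree] at this
        split_ifs with h h' h'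
        · omega
        · simp
        · simp
        · omega
    · intro z hz
      have h0 : graftingProcedure.hitMass n z = 0 := by
        by_contra h0
        have := graftingProcedure.numNodes_of_hitMass hn h0
        rw [htree] at this
        omega
      rw [hitMass, h1, h0, ite_self, zero_add]

theorem tsum_hitMass_graftingProcedure {n : ℕ} (hn : 1 ≤ n) (F : MarkedTree → ℝ≥0∞) :
    ∑' y, graftingProcedure.hitMass n y *
      (if (graftingProcedure.tree y).numNodes = n then F y else 0) =
    ∑' t : UBTree, if t.numNodes = n then
      graftWeight n * ∑' y : {x : MarkedTree | x.tree = t}, F y else 0 := by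
  have h : ∀ y, graftingProcedure.hitMass n y *
      (if (graftingProcedure.tree y).numNodes = n then F y else 0) =
      ∑' t : UBTree, if t.numNodes = n then
        graftWeight n * {x : MarkedTree | x.tree = t}.indicator F y else 0 := by
    intro y
    rw [tsum_eq_single y.tree]
    · split_ifs with h1 h2 h2
      · rw [(hitMass_graftingProcedure_aux hn).1 y h2, Set.indicator_of_mem (by simp)]
      · exact absurd h1 h2
      · exact absurd h2 h1
      · simp
    · intro t ht
      rw [Set.indicator_of_notMem (by simpa using ht.symm)]
      simp
  rw [tsum_congr h, ENNReal.tsum_comm]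
  refine tsum_congr fun t => ?_
  split_ifs
  · rw [ENNReal.tsum_mul_left, tsum_subtype]
  · simp

/-- The probability that the tree reaches `n` nodes with the mark designating no node. -/
noncomputable def graftStuck (n : ℕ) : ℝ≥0∞ :=
  ∑' t : UBTree, if t.numNodes = n then graftWeight n else 0

/-- All `n + 1` marks of a tree have equal weight, and exactly one of them is stuck. -/
theorem ofReal_successProb_graftingProcedure {n : ℕ} (hn : 1 ≤ n) :
    ENNReal.ofReal (graftingProcedure.successProb n) = (n + 1) * graftStuck n := by
  rw [successProb_eq_tsum, tsum_hitMass_graftingProcedure hn, graftStuck, ← ENNReal.tsum_mul_left]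
  refine tsum_congr fun t => ?_
  split_ifs with h
  · rw [ENNReal.tsum_set_one, encard_setOf_tree_eq, h, mul_comm]
    simp
  · simp

theorem tsum_node_eq_none (t : UBTree) (a : ℝ≥0∞) :
    ∑' y : {x : MarkedTree | x.tree = t}, (if (y : MarkedTree).node = none then a else 0) = a := by
  have h := encard_setOf_node_eq_none t
  have h1 := ENNReal.tsum_set_one {x : MarkedTree | x.tree = t ∧ x.node = none}
  rw [h, tsum_subtype _ fun _ => (1 : ℝ≥0∞)] at h1
  have h2 : ∑' x, {x : MarkedTree | x.tree = t ∧ x.node = none}.indicator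
      (fun _ => (1 : ℝ≥0∞)) x * a = a := by
    rw [ENNReal.tsum_mul_right, h1, ENat.toENNReal_one, one_mul]
  rw [tsum_subtype {x : MarkedTree | x.tree = t} fun y => if y.node = none then a else 0]
  refine Eq.trans (tsum_congr fun y => ?_) h2
  by_cases hy : y.tree = t <;> by_cases hn : y.node = none <;> simp [hy, hn]

/-- At size `n` the mark is stuck with conditional probability `1 / (n + 1)`, and then the step
fails with probability 2/3. -/
theorem reachProb_graftingProcedure_succ {n : ℕ} (hn : 1 ≤ n) :
    graftingProcedure.reachProb (n + 1) = graftingProcedure.reachProb n -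
      2 / 3 * graftingProcedure.successProb n / (n + 1) := by
  have h := graftingProcedure.reachProb_eq_succ_add hn
  have hs : graftStuck n = ENNReal.ofReal (graftingProcedure.successProb n / (n + 1)) := by
    have hn0 : (0 : ℝ) < n + 1 := by positivity
    rw [ENNReal.ofReal_div_of_pos hn0, ofReal_successProb_graftingProcedure hn,
      ENNReal.eq_div_iff (ENNReal.ofReal_pos.2 hn0).ne' ENNReal.ofReal_ne_top]
    congr 1
    rw [ENNReal.ofReal_add (by positivity) (by positivity)]
    simp
  have h2 : (2 / 3 : ℝ≥0∞) = ENNReal.ofReal (2 / 3) := by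
    rw [ENNReal.ofReal_div_of_pos (by norm_num)]; simp
  rw [tsum_hitMass_graftingProcedure hn] at h
  simp only [graftingProcedure_step_none, tsum_node_eq_none] at h
  have h3 : (∑' t : UBTree, if t.numNodes = n then graftWeight n * (2 / 3) else 0) =
      2 / 3 * graftStuck n := by
    rw [graftStuck, ← ENNReal.tsum_mul_left]
    refine tsum_congr fun t => ?_
    rw [mul_ite, mul_comm, mul_zero]
  have h4 := graftingProcedure.successProb_nonneg n
  rw [h3, hs, h2, ← ENNReal.ofReal_mul (by norm_num),
    ← ENNReal.ofReal_add (graftingProcedure.reachProb_nonneg _) (by positivity),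
    ENNReal.ofReal_eq_ofReal_iff (graftingProcedure.reachProb_nonneg _)
      (add_nonneg (graftingProcedure.reachProb_nonneg _) (by positivity))] at h
  rw [h]
  ring

/-- An increment 2 fails exactly for the stuck mark, so it goes through for `n` of the `n + 1`
marks. -/
theorem overshootProb_graftingProcedure_succ {n : ℕ} (hn : 1 ≤ n) :
    graftingProcedure.overshootProb (n + 1) =
      1 / 3 * graftingProcedure.successProb n * (n / (n + 1)) := by
  have hs : graftStuck n = ENNReal.ofReal (graftingProcedure.successProb n / (n + 1)) := by
    have hn0 : (0 : ℝ) < n + 1 := by positivity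
    rw [ENNReal.ofReal_div_of_pos hn0, ofReal_successProb_graftingProcedure hn,
      ENNReal.eq_div_iff (ENNReal.ofReal_pos.2 hn0).ne' ENNReal.ofReal_ne_top]
    congr 1
    rw [ENNReal.ofReal_add (by positivity) (by positivity)]
    simp
  have h2 : (1 / 3 : ℝ≥0∞) = ENNReal.ofReal (1 / 3) := by
    rw [ENNReal.ofReal_div_of_pos (by norm_num)]; simp
  have h4 := graftingProcedure.successProb_nonneg n
  have h : ENNReal.ofReal (graftingProcedure.overshootProb (n + 1)) + 1 / 3 * graftStuck n =
      1 / 3 * ENNReal.ofReal (graftingProcedure.successProb n) := by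
    rw [overshootProb_succ_eq_tsum _ hn, successProb_eq_tsum, tsum_hitMass_graftingProcedure hn,
      tsum_hitMass_graftingProcedure hn, graftStuck, ← ENNReal.tsum_mul_left,
      ← ENNReal.tsum_mul_left, ← ENNReal.tsum_add]
    refine tsum_congr fun t => ?_
    split_ifs
    · rw [mul_comm (1 / 3), ← mul_add]
      have h5 := tsum_node_eq_none t (1 / 3)
      nth_rewrite 2 [← h5]
      rw [mul_left_comm, ← ENNReal.tsum_add, ← ENNReal.tsum_mul_left (a := 1 / 3)]
      congr 1
      refine tsum_congr fun y => ?_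
      rw [tsum_growTwo_graftingProcedure]
      split_ifs <;> simp
    · simp
  rw [hs, h2, ← ENNReal.ofReal_mul (by norm_num), ← ENNReal.ofReal_mul (by norm_num),
    ← ENNReal.ofReal_add (graftingProcedure.overshootProb_nonneg _) (by positivity),
    ENNReal.ofReal_eq_ofReal_iff (add_nonneg (graftingProcedure.overshootProb_nonneg _)
      (by positivity)) (by positivity)] at h
  have h6 : (n : ℝ) + 1 ≠ 0 := by positivity
  field_simp at h ⊢
  linarith

/-! ### Asymptotics of the survival probabilities -/

/-- With `y = s n / p n` and `h = 1 / (n + 1)`, the recurrences read `p (n + 1) = p n (1 - (2/3) y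
h)` and `s (n + 1) - (3/4) p (n + 1) = p n (-(y - 3/4) / 3 + y h / 6)`. The deviation from 3/4 is
thus contracted by about 1/3 with an error `O(h)`, so it stays `O(1/n)`. The constant 3/2 makes the
bound trivial at `n = 1`, where it is 3/4. -/
theorem abs_sub_le_of_grafting_recurrence {p s : ℕ → ℝ} (h1 : 0 < p 1) (hs0 : ∀ n, 0 ≤ s n)
    (hs1 : ∀ n, s n ≤ p n)
    (hp : ∀ n : ℕ, 1 ≤ n → p (n + 1) = p n - 2 / 3 * s n / (n + 1))
    (hs : ∀ n : ℕ, 1 ≤ n → p (n + 1) = s (n + 1) + 1 / 3 * s n * (n / (n + 1))) {n : ℕ}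
    (hn : 1 ≤ n) : 0 < p n ∧ |s n / p n - 3 / 4| ≤ 3 / 2 / (n + 1) := by
  induction n, hn using Nat.le_induction with
  | base =>
    refine ⟨h1, ?_⟩
    have h2 : 0 ≤ s 1 / p 1 := div_nonneg (hs0 1) h1.le
    have h3 : s 1 / p 1 ≤ 1 := div_le_one_of_le₀ (hs1 1) h1.le
    rw [abs_le]
    constructor <;> push_cast <;> linarith
  | succ n hn ih =>
    obtain ⟨hpos, habs⟩ := ih
    have e1 := hp n hn
    have e2 := hs n hn
    have hn' : (1 : ℝ) ≤ n := by exact_mod_cast hn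
    have hn1 : (0 : ℝ) < n + 1 := by positivity
    have hy0 : 0 ≤ s n / p n := div_nonneg (hs0 n) hpos.le
    have hy1 : s n / p n ≤ 1 := div_le_one_of_le₀ (hs1 n) hpos.le
    have hsy : s n = p n * (s n / p n) := by field_simp
    set y := s n / p n
    set h : ℝ := 1 / (n + 1) with hh
    have hh2 : h ≤ 1 / 2 := by
      rw [hh]; exact one_div_le_one_div_of_le (by norm_num) (by linarith)
    have hh0 : 0 < h := by positivity
    have hx3 : |y - 3 / 4| ≤ 3 / 2 * h := by rw [hh]; convert habs using 1; ring
    have hnn : (n : ℝ) / (n + 1) = 1 - h := by rw [hh]; field_simp; ring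
    have hyh : y * h ≤ h := by nlinarith
    have hyh0 : 0 ≤ y * h := by positivity
    have e1' : p (n + 1) = p n * (1 - 2 / 3 * (y * h)) := by
      rw [e1, hsy, hh]; field_simp
    have e2' : s (n + 1) - 3 / 4 * p (n + 1) = p n * (-(y - 3 / 4) / 3 + y * h / 6) := by
      have : s (n + 1) = p (n + 1) - 1 / 3 * s n * (1 - h) := by rw [← hnn]; linarith
      rw [this, e1', hsy]; ring
    have hq : 0 < 1 - 2 / 3 * (y * h) := by linarith
    have hp' : 0 < p (n + 1) := by rw [e1']; exact mul_pos hpos hq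
    refine ⟨hp', ?_⟩
    have e3 : s (n + 1) / p (n + 1) - 3 / 4 =
        (-(y - 3 / 4) / 3 + y * h / 6) / (1 - 2 / 3 * (y * h)) := by
      rw [div_sub' hp'.ne', mul_comm, e2', e1', mul_div_mul_left _ _ hpos.ne']
    have e4 : 3 / 2 / (((n + 1 : ℕ) : ℝ) + 1) = 3 / 2 * h / (1 + h) := by
      rw [hh]; push_cast; field_simp
    obtain ⟨hxl, hxu⟩ := abs_le.1 hx3
    rw [e3, e4, abs_div, abs_of_pos hq, div_le_div_iff₀ hq (by positivity)]
    have h5 : |-(y - 3 / 4) / 3 + y * h / 6| ≤ 2 / 3 * h := by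
      rw [abs_le]; constructor <;> linarith
    calc |-(y - 3 / 4) / 3 + y * h / 6| * (1 + h) ≤ 2 / 3 * h * (1 + h) := by gcongr
      -- After division by `h` this is equivalent to `h ≤ 1/2`, with equality at `n = 1`.
      _ ≤ 3 / 2 * h * (1 - 2 / 3 * h) := by nlinarith
      _ ≤ 3 / 2 * h * (1 - 2 / 3 * (y * h)) := by gcongr

/-- At `y = 3/4` the square is `(1 - h / 2) ^ 2 = 1 - h + h ^ 2 / 4`, so the first-order terms
cancel; a deviation of order `h` in `y` again costs only `O(h ^ 2)`. -/
theorem abs_sq_sub_div_le {y h : ℝ} (hh0 : 0 < h) (hh2 : h ≤ 1 / 2)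
    (hy : |y - 3 / 4| ≤ 3 / 2 * h) :
    |((1 - 2 / 3 * y * h) ^ 2 - (1 - h)) / (1 - h)| ≤ 8 * h ^ 2 := by
  obtain ⟨ε, hε⟩ : ∃ ε, ε = 2 / 3 * (y - 3 / 4) * h := ⟨_, rfl⟩
  have hεb : |ε| ≤ h ^ 2 := by
    rw [hε, abs_mul, abs_mul, abs_of_pos hh0, abs_of_pos (by norm_num : (0 : ℝ) < 2 / 3)]
    nlinarith
  obtain ⟨hl, hr⟩ := abs_le.1 hεb
  have e6 : (1 - 2 / 3 * y * h) ^ 2 - (1 - h) = h ^ 2 / 4 - ε * (2 - h) + ε ^ 2 := by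
    rw [hε]; ring
  have hε2 : ε ^ 2 ≤ h ^ 2 := by
    rw [← sq_abs ε]
    have : |ε| ≤ h := by nlinarith
    gcongr
  have hnum : |(1 - 2 / 3 * y * h) ^ 2 - (1 - h)| ≤ 4 * h ^ 2 := by
    rw [e6, abs_le]
    have h3 : ε * (2 - h) ≤ h ^ 2 * (2 - h) := mul_le_mul_of_nonneg_right hr (by linarith)
    have h4 : -h ^ 2 * (2 - h) ≤ ε * (2 - h) := mul_le_mul_of_nonneg_right hl (by linarith)
    have h5 : 0 < h ^ 3 := by positivity
    constructor <;> nlinarith [sq_nonneg ε]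
  rw [abs_div, abs_of_pos (by linarith : 0 < 1 - h), div_le_iff₀ (by linarith)]
  have h6 : h ^ 2 * h ≤ h ^ 2 * (1 / 2) := by gcongr
  linarith

/-- The consecutive ratios of `n * p n ^ 2` are `1 + O(1 / n ^ 2)` and nonzero, so their infinite
product converges to a nonzero limit. -/
theorem exists_tendsto_mul_sq_of_grafting_recurrence {p s : ℕ → ℝ} (h1 : 0 < p 1)
    (hs0 : ∀ n, 0 ≤ s n) (hs1 : ∀ n, s n ≤ p n)
    (hp : ∀ n : ℕ, 1 ≤ n → p (n + 1) = p n - 2 / 3 * s n / (n + 1))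
    (hs : ∀ n : ℕ, 1 ≤ n → p (n + 1) = s (n + 1) + 1 / 3 * s n * (n / (n + 1))) :
    ∃ L : ℝ, 0 < L ∧ Tendsto (fun n : ℕ => n * p n ^ 2) atTop (𝓝 L) := by
  have key := fun n : ℕ => abs_sub_le_of_grafting_recurrence h1 hs0 hs1 hp hs
    (Nat.succ_le_succ (Nat.zero_le n))
  obtain ⟨u, hu⟩ : ∃ u : ℕ → ℝ, ∀ n, u n = ((n : ℝ) + 1) * p (n + 1) ^ 2 := ⟨_, fun n => rfl⟩
  have hupos : ∀ n, 0 < u n := fun n => by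
    have := (key n).1
    rw [hu]
    positivity
  obtain ⟨f, hf⟩ : ∃ f : ℕ → ℝ, ∀ n, f n = u (n + 1) / u n - 1 := ⟨_, fun n => rfl⟩
  have hfb : ∀ n : ℕ, ‖f n‖ ≤ 8 * (1 / ((n + 2 : ℕ) : ℝ) ^ 2) := by
    intro n
    obtain ⟨hpos, habs⟩ := key n
    have e1 := hp (n + 1) (by omega)
    have hn1 : (0 : ℝ) < (n : ℝ) + 1 := by positivity
    have hn2 : (0 : ℝ) < (n : ℝ) + 2 := by positivity
    obtain ⟨y, hy⟩ : ∃ y, y = s (n + 1) / p (n + 1) := ⟨_, rfl⟩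
    have hsy : s (n + 1) = p (n + 1) * y := by rw [hy]; field_simp
    have e1' : p (n + 1 + 1) = p (n + 1) * (1 - 2 / 3 * y * (1 / ((n : ℝ) + 2))) := by
      rw [e1, hsy]; push_cast; field_simp; ring
    have e5 : f n = ((1 - 2 / 3 * y * (1 / ((n : ℝ) + 2))) ^ 2 - (1 - 1 / ((n : ℝ) + 2))) /
        (1 - 1 / ((n : ℝ) + 2)) := by
      have : 1 - 1 / ((n : ℝ) + 2) = ((n : ℝ) + 1) / (n + 2) := by field_simp; ring
      rw [hf, hu, hu, e1', this, mul_pow, sub_div, div_self (by positivity)]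
      push_cast
      field_simp
      ring
    rw [e5, Real.norm_eq_abs]
    refine (abs_sq_sub_div_le (by positivity) ?_ ?_).trans_eq ?_
    · exact one_div_le_one_div_of_le (by norm_num) (by linarith)
    · rw [hy]
      refine habs.trans_eq ?_
      push_cast
      ring
    · push_cast
      rw [div_pow, one_pow]
  have hsum : Summable fun n => ‖f n‖ := by
    refine Summable.of_nonneg_of_le (fun n => norm_nonneg _) hfb (Summable.mul_left _ ?_)
    exact (summable_nat_add_iff 2).2 (Real.summable_one_div_nat_pow.2 (by norm_num : 1 < 2))
  have hratio : ∀ n, 1 + f n = u (n + 1) / u n := fun n => by rw [hf]; ring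
  have hprod : ∀ n, ∏ i ∈ Finset.range n, (1 + f i) = u n / u 0 := by
    intro n
    induction n with
    | zero => simp [(hupos 0).ne']
    | succ n ih =>
      rw [Finset.prod_range_succ, ih, hratio, mul_comm, div_mul_div_cancel₀ (hupos n).ne']
  have hlim := (multipliable_one_add_of_summable hsum).hasProd.tendsto_prod_nat
  have hne := tprod_one_add_ne_zero_of_summable
    (fun n => by rw [hratio]; exact (div_pos (hupos _) (hupos _)).ne') hsum
  have hge : 0 ≤ ∏' i, (1 + f i) := ge_of_tendsto' hlim fun n => by
    rw [hprod]; exact (div_pos (hupos _) (hupos _)).le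
  refine ⟨u 0 * ∏' i, (1 + f i), mul_pos (hupos 0) (lt_of_le_of_ne hge hne.symm), ?_⟩
  rw [← tendsto_add_atTop_iff_nat 1]
  refine (hlim.const_mul (u 0)).congr fun n => ?_
  rw [hprod, mul_div_cancel₀ _ (hupos 0).ne', hu]
  push_cast
  ring

theorem graftingProcedure_hasSquareRootSurvival : graftingProcedure.HasSquareRootSurvival := by
  open GrowthProcedure in
  obtain ⟨L, hL, h⟩ := exists_tendsto_mul_sq_of_grafting_recurrence
    (p := graftingProcedure.reachProb) (s := graftingProcedure.successProb)
    (by rw [reachProb_of_le_one _ le_rfl]; norm_num) (graftingProcedure.successProb_nonneg)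
    (fun n => by
      rw [reachProb_eq]; exact le_add_of_nonneg_right (graftingProcedure.overshootProb_nonneg n))
    (fun n hn => reachProb_graftingProcedure_succ hn)
    (fun n hn => by rw [reachProb_eq, overshootProb_graftingProcedure_succ hn])
  refine ⟨√L, Real.sqrt_pos.2 hL, ?_⟩
  have h2 := (Real.continuous_sqrt.tendsto L).comp h
  rw [Asymptotics.isEquivalent_iff_tendsto_one]
  · have h3 := h2.div_const (√L)
    rw [div_self (Real.sqrt_pos.2 hL).ne'] at h3
    refine h3.congr' ?_
    filter_upwards [eventually_gt_atTop 0] with n hn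
    have hn' : (0 : ℝ) < n := by exact_mod_cast hn
    simp only [Function.comp, Pi.div_apply]
    rw [Real.sqrt_mul hn'.le, Real.sqrt_sq (graftingProcedure.reachProb_nonneg n),
      Real.rpow_neg hn'.le, ← Real.sqrt_eq_rpow]
    have := Real.sqrt_pos.2 hn'
    have := Real.sqrt_pos.2 hL
    field_simp
  · filter_upwards [eventually_gt_atTop 0] with n hn
    have hn' : (0 : ℝ) < n := by exact_mod_cast hn
    have := Real.sqrt_pos.2 hL
    positivity

theorem tendsto_zero_of_le_third {a b : ℕ → ℝ} (ha : ∀ n, 0 ≤ a n)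
    (hab : ∀ᶠ n in atTop, a (n + 1) ≤ a n / 3 + b n) (hb : Tendsto b atTop (𝓝 0)) :
    Tendsto a atTop (𝓝 0) := by
  rw [Metric.tendsto_atTop]
  intro ε hε
  obtain ⟨N, hN⟩ := eventually_atTop.1 (hab.and (hb.eventually (gt_mem_nhds (by linarith : 0 < ε / 3))))
  -- `ε / 2` is the fixed point of `x ↦ x / 3 + ε / 3`.
  have h1 : ∀ k, a (N + k) ≤ (1 / 3) ^ k * a N + ε / 2 := by
    intro k
    induction k with
    | zero => simp; linarith
    | succ k ih =>
      obtain ⟨h1, h2⟩ := hN (N + k) (by omega)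
      rw [← add_assoc, pow_succ]
      linarith
  have h2 : Tendsto (fun k : ℕ => (1 / 3 : ℝ) ^ k * a N) atTop (𝓝 (0 * a N)) :=
    (tendsto_pow_atTop_nhds_zero_of_lt_one (by norm_num) (by norm_num)).mul_const _
  rw [zero_mul] at h2
  obtain ⟨K, hK⟩ := eventually_atTop.1 (h2.eventually (gt_mem_nhds (by linarith : 0 < ε / 2)))
  refine ⟨N + K, fun n hn => ?_⟩
  obtain ⟨k, rfl⟩ : ∃ k, n = N + k := ⟨n - N, by omega⟩
  rw [Real.dist_eq, sub_zero, abs_of_nonneg (ha _)]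
  linarith [h1 k, hK k (by omega)]

/-- The sequence `p` decays like a constant multiple of `n ^ (-1/2)`. -/
def SquareRootDecay (p : ℕ → ℝ) : Prop :=
  ∃ c : ℝ, 0 < c ∧ p ~[atTop] fun n : ℕ => c * (n : ℝ) ^ (-(1 / 2) : ℝ)

namespace SquareRootDecay

variable {p : ℕ → ℝ}

theorem tendsto_mul_sqrt (h : SquareRootDecay p) :
    ∃ c : ℝ, 0 < c ∧ Tendsto (fun n : ℕ => p n * √n) atTop (𝓝 c) := by
  obtain ⟨c, hc, h⟩ := h
  refine ⟨c, hc, ?_⟩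
  have hne : ∀ᶠ n : ℕ in atTop, c * (n : ℝ) ^ (-(1 / 2) : ℝ) ≠ 0 := by
    filter_upwards [eventually_gt_atTop 0] with n hn
    have hn' : (0 : ℝ) < n := by exact_mod_cast hn
    positivity
  have h2 := ((Asymptotics.isEquivalent_iff_tendsto_one hne).1 h).mul_const c
  rw [one_mul] at h2
  refine h2.congr' ?_
  filter_upwards [eventually_gt_atTop 0] with n hn
  have hn' : (0 : ℝ) < n := by exact_mod_cast hn
  simp only [Pi.div_apply]
  rw [Real.rpow_neg hn'.le, ← Real.sqrt_eq_rpow]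
  have := Real.sqrt_pos.2 hn'
  field_simp

theorem eventually_pos (h : SquareRootDecay p) : ∀ᶠ n in atTop, 0 < p n := by
  obtain ⟨c, hc, h⟩ := h.tendsto_mul_sqrt
  filter_upwards [h.eventually (lt_mem_nhds hc)] with n hn
  exact pos_of_mul_pos_left hn (Real.sqrt_nonneg _)

theorem tendsto_ratio (h : SquareRootDecay p) :
    Tendsto (fun n => p (n + 1) / p n) atTop (𝓝 1) := by
  obtain ⟨c, hc, h⟩ := h.tendsto_mul_sqrt
  have h1 := ((h.comp (tendsto_add_atTop_nat 1)).div h hc.ne')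
  rw [div_self hc.ne'] at h1
  have h2 : Tendsto (fun n : ℕ => √((n : ℝ) / ((n + 1 : ℕ) : ℝ))) atTop (𝓝 1) := by
    have := (Real.continuous_sqrt.tendsto 1).comp (tendsto_natCast_div_add_atTop (1 : ℝ))
    rw [Real.sqrt_one] at this
    exact this.congr fun n => by simp only [Function.comp, Nat.cast_add, Nat.cast_one]
  have h3 := h1.mul h2
  rw [mul_one] at h3
  refine h3.congr' ?_
  filter_upwards [eventually_gt_atTop 0] with n hn
  have hn' : (0 : ℝ) < n := by exact_mod_cast hn
  have h4 := Real.sqrt_pos.2 hn'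
  have h5 : 0 < √((n + 1 : ℕ) : ℝ) := Real.sqrt_pos.2 (by positivity)
  simp only [Function.comp, Pi.div_apply]
  rw [Real.sqrt_div hn'.le]
  field_simp

/-- The success probability is asymptotically three quarters of the survival probability. -/
theorem tendsto_success_ratio (h : SquareRootDecay p) {s d : ℕ → ℝ} (hs0 : ∀ n, 0 ≤ s n)
    (hd0 : ∀ n, 0 ≤ d n) (hp : ∀ n, p n = s n + d n)
    (h1 : ∀ n, 1 ≤ n → d (n + 1) ≤ 1 / 3 * s n)
    (h2 : ∀ n, 1 ≤ n → 1 / 3 * s n ≤ d (n + 1) + (p n - p (n + 1))) :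
    Tendsto (fun n => s n / p n) atTop (𝓝 (3 / 4)) := by
  rw [tendsto_iff_norm_sub_tendsto_zero]
  have hr := h.tendsto_ratio
  have hb : Tendsto (fun n => 4 / 3 * |(p (n + 1) / p n)⁻¹ - 1|) atTop (𝓝 0) := by
    have := (((hr.inv₀ one_ne_zero).sub_const 1).abs).const_mul (4 / 3)
    simpa using this
  refine tendsto_zero_of_le_third (fun n => norm_nonneg _) ?_ hb
  have hpos := h.eventually_pos
  filter_upwards [hpos, (tendsto_add_atTop_nat 1).eventually hpos, eventually_ge_atTop 1]
    with n hn hn1 h0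
  have e0 := hp n
  have e1 := hp (n + 1)
  have hx1 : s n / p n ≤ 1 := div_le_one_of_le₀ (by linarith [hd0 n]) hn.le
  have hx0 : 0 ≤ s n / p n := div_nonneg (hs0 n) hn.le
  -- `3/4` is the fixed point of `x ↦ 1 - x / 3`. The two corrections come from replacing `p n / p
  -- (n + 1)` by 1 and `d (n + 1)` by `s n / 3`; they contribute 1/3 and 1 to the factor 4/3 in
  -- `hb`.
  have e2 : s (n + 1) / p (n + 1) - 3 / 4 = -(1 / 3) * (s n / p n - 3 / 4) +
      (-(1 / 3) * (s n / p n) * ((p (n + 1) / p n)⁻¹ - 1) +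
        (1 / 3 * s n - d (n + 1)) / p (n + 1)) := by
    rw [show s (n + 1) = p (n + 1) - d (n + 1) by linarith]
    field_simp
    ring
  have e3 : |(1 / 3 * s n - d (n + 1)) / p (n + 1)| ≤ |(p (n + 1) / p n)⁻¹ - 1| := by
    have : (p (n + 1) / p n)⁻¹ - 1 = (p n - p (n + 1)) / p (n + 1) := by field_simp
    rw [this, abs_div, abs_div]
    gcongr ?_ / _
    rw [abs_of_nonneg (by linarith [h1 n h0])]
    exact le_trans (by linarith [h2 n h0]) (le_abs_self _)
  have e4 : |-(1 / 3) * (s n / p n) * ((p (n + 1) / p n)⁻¹ - 1)| ≤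
      1 / 3 * |(p (n + 1) / p n)⁻¹ - 1| := by
    rw [abs_mul, abs_mul, abs_of_nonneg hx0, abs_neg, abs_of_pos (by norm_num : (0 : ℝ) < 1 / 3)]
    gcongr
    linarith
  rw [Real.norm_eq_abs, Real.norm_eq_abs, e2]
  refine (abs_add_le _ _).trans ?_
  refine (add_le_add_right (abs_add_le _ _) _).trans ?_
  rw [abs_mul, abs_neg, abs_of_pos (by norm_num : (0 : ℝ) < 1 / 3)]
  linarith

end SquareRootDecay

/-! ### Power moments and transforms under square root decay. -/

theorem tendsto_rpow_succ_sub_rpow (β : ℝ) :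
    Tendsto (fun m : ℕ => (((m : ℝ) + 1) ^ β - (m : ℝ) ^ β) / (m : ℝ) ^ (β - 1)) atTop (𝓝 β) := by
  have h := hasDerivAt_iff_tendsto_slope_zero.1 (Real.hasDerivAt_rpow_const (x := 1) (p := β)
    (Or.inl one_ne_zero))
  have h0 : Tendsto (fun m : ℕ => (1 / (m : ℝ))) atTop (𝓝[≠] 0) := by
    refine tendsto_nhdsWithin_iff.2 ⟨tendsto_one_div_atTop_nhds_zero_nat, ?_⟩
    filter_upwards [eventually_gt_atTop 0] with n hn
    have hn' : (0 : ℝ) < n := by exact_mod_cast hn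
    simp [hn'.ne']
  have h1 := h.comp h0
  rw [Real.one_rpow, Real.one_rpow, mul_one] at h1
  refine h1.congr' ?_
  filter_upwards [eventually_gt_atTop 0] with n hn
  have hn' : (0 : ℝ) < n := by exact_mod_cast hn
  have h2 : (n : ℝ) + 1 = n * (1 + 1 / n) := by field_simp
  simp only [Function.comp, smul_eq_mul]
  rw [h2, Real.mul_rpow hn'.le (by positivity), Real.rpow_sub hn', Real.rpow_one]
  have h3 := Real.rpow_pos_of_pos hn' β
  field_simp

namespace SquareRootDecay

variable {p : ℕ → ℝ}

/-- With `β = k + 1/2`, the terms `p (m + 1) m ^ k ~ c m ^ (β - 1)` are equivalent to the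
telescoping increments of `(c / β) m ^ β`. The sums of the latter diverge, so the partial sums are
equivalent too, while `n ^ k * n * p n ~ c n ^ β`. -/
theorem tendsto_moment (h : SquareRootDecay p) (k : ℕ) :
    Tendsto (fun n : ℕ => (∑ m ∈ Finset.range n, p (m + 1) * ((m : ℝ) / n) ^ k) / (n * p n))
      atTop (𝓝 (1 / (k + 1 / 2))) := by
  have hpos := h.eventually_pos
  have hratio := h.tendsto_ratio
  obtain ⟨c, hc, hlim⟩ := h.tendsto_mul_sqrt
  obtain ⟨β, hβ⟩ : ∃ β : ℝ, β = k + 1 / 2 := ⟨_, rfl⟩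
  have hβ0 : 0 < β := by rw [hβ]; positivity
  have hpow : ∀ n : ℕ, 0 < n → (n : ℝ) ^ β = n ^ k * √n := fun n hn => by
    have hn' : (0 : ℝ) < n := by exact_mod_cast hn
    rw [hβ, Real.rpow_add hn', Real.rpow_natCast, Real.sqrt_eq_rpow]
  set v : ℕ → ℝ := fun m => c / β * (((m : ℝ) + 1) ^ β - (m : ℝ) ^ β) with hv
  set u : ℕ → ℝ := fun m => p (m + 1) * (m : ℝ) ^ k with hu
  have hvpos : ∀ m, 0 < v m := fun m => by
    have : (m : ℝ) ^ β < ((m : ℝ) + 1) ^ β :=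
      Real.rpow_lt_rpow (by positivity) (by linarith) hβ0
    exact mul_pos (by positivity) (by linarith)
  have hvsum : ∀ n, ∑ m ∈ Finset.range n, v m = c / β * (n : ℝ) ^ β := by
    intro n
    rw [← Finset.mul_sum]
    have := Finset.sum_range_sub (fun m : ℕ => (m : ℝ) ^ β) n
    push_cast at this
    rw [this, Real.zero_rpow hβ0.ne', sub_zero]
  have huv : u ~[atTop] v := by
    rw [Asymptotics.isEquivalent_iff_tendsto_one (Eventually.of_forall fun m => (hvpos m).ne')]
    have h1 := (tendsto_rpow_succ_sub_rpow β).const_mul (c / β)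
    have h2 := hratio.mul hlim
    have h3 := h2.div h1 (by positivity)
    rw [one_mul, div_mul_cancel₀ _ hβ0.ne', div_self hc.ne'] at h3
    refine h3.congr' ?_
    filter_upwards [eventually_gt_atTop 0, hpos] with n hn hpn
    have hn' : (0 : ℝ) < n := by exact_mod_cast hn
    have hs := Real.sqrt_pos.2 hn'
    have h4 : (n : ℝ) ^ (β - 1) * √n = n ^ k := by
      rw [hβ, Real.sqrt_eq_rpow, ← Real.rpow_add hn', ← Real.rpow_natCast]
      congr 1
      ring
    have h5 : 0 < (n : ℝ) ^ (β - 1) := Real.rpow_pos_of_pos hn' _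
    have h6 := (hvpos n).ne'
    simp only [Pi.div_apply, hu]
    rw [← h4, show p (n + 1) / p n * (p n * √n) = p (n + 1) * √n by field_simp,
      ← mul_div_assoc (c / β)]
    change p (n + 1) * √n / (v n / _) = _
    field_simp
  have hVtop : Tendsto (fun n => ∑ m ∈ Finset.range n, v m) atTop atTop := by
    simp only [hvsum]
    exact ((tendsto_rpow_atTop hβ0).comp tendsto_natCast_atTop_atTop).const_mul_atTop
      (by positivity)
  have hU : (fun n => ∑ m ∈ Finset.range n, u m) ~[atTop] fun n => ∑ m ∈ Finset.range n, v m := by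
    have := Asymptotics.IsLittleO.sum_range huv.isLittleO (fun m => (hvpos m).le) hVtop
    refine this.congr_left fun n => ?_
    simp [Finset.sum_sub_distrib]
  have h7 := (Asymptotics.isEquivalent_iff_tendsto_one
    (hVtop.eventually_ne_atTop 0)).1 hU
  have h8 := (h7.mul_const (c / β)).div hlim hc.ne'
  rw [one_mul, div_div_cancel_left' hc.ne', ← one_div] at h8
  rw [← hβ]
  refine h8.congr' ?_
  filter_upwards [eventually_gt_atTop 0, hpos] with n hn hpn
  have hn' : (0 : ℝ) < n := by exact_mod_cast hn
  have hs := Real.sqrt_pos.2 hn'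
  have hss := Real.mul_self_sqrt hn'.le
  simp only [Pi.div_apply]
  rw [hvsum, hpow n hn, hu]
  simp only [div_pow, ← mul_div_assoc, ← Finset.sum_div]
  field_simp
  rw [Real.sq_sqrt hn'.le]

end SquareRootDecay

/-- The function `∫₀¹ exp (i s x) x ^ (-1/2) dx`, as a power series. -/
noncomputable def sqrtTransform (s : ℝ) : ℂ :=
  ∑' k : ℕ, (Complex.I * s) ^ k / (k.factorial : ℂ) * (1 / ((k : ℂ) + 1 / 2))

/-- Expand `exp (i s m / n)` in powers of `m / n` and pass to the limit in each moment. As `m / n ≤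
1`, all moments are dominated by the zeroth. -/
theorem tendsto_sum_mul_exp {p : ℕ → ℝ} (h : SquareRootDecay p) (hp : ∀ n, 0 ≤ p n) (s : ℝ) :
    Tendsto (fun n : ℕ => (∑ m ∈ Finset.range n,
      (p (m + 1) : ℂ) * Complex.exp (Complex.I * s / n) ^ m) / (n * p n))
      atTop (𝓝 (sqrtTransform s)) := by
  have hexp : ∀ n : ℕ, (∑ m ∈ Finset.range n,
      (p (m + 1) : ℂ) * Complex.exp (Complex.I * s / n) ^ m) / (n * p n) =
      ∑' k : ℕ, (Complex.I * s) ^ k / (k.factorial : ℂ) *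
        (((∑ m ∈ Finset.range n, p (m + 1) * ((m : ℝ) / n) ^ k) / (n * p n) : ℝ) : ℂ) := by
    intro n
    have h1 : ∀ m ∈ Finset.range n, HasSum (fun k : ℕ => (Complex.I * s) ^ k / (k.factorial : ℂ) *
        ((p (m + 1) * ((m : ℝ) / n) ^ k / (n * p n) : ℝ) : ℂ))
        ((p (m + 1) : ℂ) * Complex.exp (Complex.I * s / n) ^ m / (n * p n)) := by
      intro m _
      rw [← Complex.exp_nat_mul]
      have h2 := NormedSpace.expSeries_div_hasSum_exp (𝔸 := ℂ)
        ((m : ℂ) * (Complex.I * s / n))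
      rw [← Complex.exp_eq_exp_ℂ] at h2
      have h3 := (h2.mul_left (p (m + 1) : ℂ)).div_const ((n : ℂ) * p n)
      refine h3.congr_fun fun k => ?_
      push_cast
      rw [show (m : ℂ) * (Complex.I * s / n) = Complex.I * s * (m / n) by ring, mul_pow]
      ring
    have h4 := hasSum_sum h1
    rw [Finset.sum_div, ← h4.tsum_eq]
    refine tsum_congr fun k => ?_
    rw [Finset.sum_div, Complex.ofReal_sum, Finset.mul_sum]
  simp only [hexp]
  have hM0 := h.tendsto_moment 0
  -- The zeroth moment tends to 2, so it is eventually below 3.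
  have hlt : (1 : ℝ) / ((0 : ℕ) + 1 / 2) < 3 := by norm_num
  refine tendsto_tsum_of_dominated_convergence
    (bound := fun k : ℕ => |s| ^ k / k.factorial * 3) ?_ ?_ ?_
  · exact (Real.summable_pow_div_factorial |s|).mul_right 3
  · intro k
    refine Tendsto.const_mul _ ?_
    have := (Complex.continuous_ofReal.tendsto _).comp (h.tendsto_moment k)
    rwa [show ((1 / (k + 1 / 2) : ℝ) : ℂ) = 1 / ((k : ℂ) + 1 / 2) by push_cast; rfl] at this
  · filter_upwards [hM0.eventually (gt_mem_nhds hlt), eventually_gt_atTop 0] with n hn hn0 k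
    have hn' : (0 : ℝ) < n := by exact_mod_cast hn0
    rw [norm_mul, norm_div, norm_pow, norm_mul, Complex.norm_I, one_mul, Complex.norm_real,
      Real.norm_eq_abs, Complex.norm_natCast, Complex.norm_real, Real.norm_eq_abs]
    gcongr
    have hnn : 0 ≤ n * p n := mul_nonneg hn'.le (hp n)
    rw [abs_of_nonneg (div_nonneg (Finset.sum_nonneg fun m _ =>
      mul_nonneg (hp _) (by positivity)) hnn)]
    refine le_trans ?_ hn.le
    refine div_le_div_of_nonneg_right (Finset.sum_le_sum fun m hm =>
      mul_le_mul_of_nonneg_left ?_ (hp _)) hnn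
    have : (m : ℝ) / n ≤ 1 :=
      div_le_one_of_le₀ (by exact_mod_cast (Finset.mem_range.1 hm).le) hn'.le
    rw [pow_zero]
    exact pow_le_one₀ (by positivity) this

/-- The reciprocal of the characteristic function of the Darling--Mandelbrot distribution of
parameter `1/2`. -/
noncomputable def halfSymbol (s : ℝ) : ℂ :=
  Complex.exp (Complex.I * s) - Complex.I * s * sqrtTransform s

theorem summable_sqrtTransform (s : ℝ) : Summable fun k : ℕ =>
    (Complex.I * s) ^ k / (k.factorial : ℂ) * (1 / ((k : ℂ) + 1 / 2)) := by
  refine Summable.of_norm_bounded ((Real.summable_pow_div_factorial |s|).mul_right 2) fun k => ?_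
  rw [norm_mul, norm_div, norm_pow, norm_mul, Complex.norm_I, one_mul, Complex.norm_real,
      Real.norm_eq_abs, Complex.norm_natCast]
  gcongr
  rw [norm_div, norm_one, show ((k : ℂ) + 1 / 2) = ((k + 1 / 2 : ℝ) : ℂ) by push_cast; ring,
    Complex.norm_real, Real.norm_eq_abs, abs_of_pos (by positivity)]
  rw [div_le_iff₀ (by positivity)]
  have : (0 : ℝ) ≤ k := by positivity
  linarith

/-- Compare coefficients of `(i s) ^ n` for `n ≥ 1`: `1 / n! - 1 / ((n - 1)! (n - 1/2)) = -(1/2) /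
((n - 1/2) n!)`. -/
theorem halfSymbol_eq (s : ℝ) : halfSymbol s =
    1 - ∑' n : ℕ, (((1 / 2 : ℝ) : ℂ) / (((n + 1 : ℕ) : ℂ) - ((1 / 2 : ℝ) : ℂ))) *
      (Complex.I * s) ^ (n + 1) / ((n + 1).factorial : ℂ) := by
  have h1 := NormedSpace.expSeries_div_hasSum_exp (𝔸 := ℂ) (Complex.I * s)
  rw [← Complex.exp_eq_exp_ℂ] at h1
  have h2 := (hasSum_nat_add_iff' 1).2 h1
  have h3 := (summable_sqrtTransform s).hasSum.mul_left (Complex.I * s)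
  have h4 := (h2.sub h3).neg
  rw [Finset.sum_range_one, pow_zero, Nat.factorial_zero, Nat.cast_one, div_one] at h4
  have h5 : HasSum (fun n : ℕ => (((1 / 2 : ℝ) : ℂ) / (((n + 1 : ℕ) : ℂ) - ((1 / 2 : ℝ) : ℂ))) *
      (Complex.I * s) ^ (n + 1) / ((n + 1).factorial : ℂ))
      (-(Complex.exp (Complex.I * s) - 1 - Complex.I * s * sqrtTransform s)) := by
    refine h4.congr_fun fun n => ?_
    have e1 : (n.factorial : ℂ) ≠ 0 := by exact_mod_cast n.factorial_ne_zero
    have e2 : (n : ℂ) + 1 ≠ 0 := by exact_mod_cast n.succ_ne_zero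
    have e3 : (n : ℂ) * 2 + 1 ≠ 0 := by exact_mod_cast (n * 2).succ_ne_zero
    have e3' : 2 * (n : ℂ) + 1 ≠ 0 := by rwa [mul_comm] at e3
    have e4 : (n : ℂ) + 1 / 2 = (n * 2 + 1) / 2 := by ring
    have e5 : (n : ℂ) + 1 - 1 / 2 = (n * 2 + 1) / 2 := by ring
    rw [Nat.factorial_succ]
    push_cast
    rw [e4, e5]
    field_simp
    ring
  rw [h5.tsum_eq, halfSymbol]
  ring

theorem sum_sub_succ_mul_pow {R : Type*} [CommRing R] (p : ℕ → R) (z : R) (n : ℕ) :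
    ∑ m ∈ Finset.range n, (p m - p (m + 1)) * z ^ m =
      (z - 1) * ∑ m ∈ Finset.range n, p (m + 1) * z ^ m + p 0 - p n * z ^ n := by
  induction n with
  | zero => simp
  | succ n ih =>
    rw [Finset.sum_range_succ, Finset.sum_range_succ, ih]
    ring

theorem tendsto_mul_exp_sub_one (s : ℝ) :
    Tendsto (fun n : ℕ => (n : ℂ) * (Complex.exp (Complex.I * s / n) - 1)) atTop
      (𝓝 (Complex.I * s)) := by
  have h : HasDerivAt (fun x : ℝ => Complex.exp (Complex.I * s * x)) (Complex.I * s) 0 := by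
    have h1 : HasDerivAt (fun x : ℂ => Complex.exp (Complex.I * s * x))
        (Complex.exp (Complex.I * s * ((0 : ℝ) : ℂ)) * (Complex.I * s * 1)) ((0 : ℝ) : ℂ) :=
      ((hasDerivAt_id _).const_mul _).cexp
    simpa using h1.comp_ofReal
  have h0 : Tendsto (fun m : ℕ => (1 / (m : ℝ))) atTop (𝓝[≠] 0) := by
    refine tendsto_nhdsWithin_iff.2 ⟨tendsto_one_div_atTop_nhds_zero_nat, ?_⟩
    filter_upwards [eventually_gt_atTop 0] with n hn
    have hn' : (0 : ℝ) < n := by exact_mod_cast hn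
    simp [hn'.ne']
  refine ((hasDerivAt_iff_tendsto_slope_zero.1 h).comp h0).congr fun n => ?_
  simp [Function.comp, div_eq_mul_inv]

theorem exp_div_natCast_pow {n : ℕ} (hn : 0 < n) (s : ℝ) :
    Complex.exp (Complex.I * s / n) ^ n = Complex.exp (Complex.I * s) := by
  have : (n : ℂ) ≠ 0 := by exact_mod_cast hn.ne'
  rw [← Complex.exp_nat_mul, mul_div_cancel₀ _ this]

theorem tendsto_exp_div_natCast (s : ℝ) :
    Tendsto (fun n : ℕ => Complex.exp (Complex.I * s / n)) atTop (𝓝 1) := by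
  have h : Tendsto (fun n : ℕ => Complex.I * s / n) atTop (𝓝 0) :=
    tendsto_const_div_atTop_nhds_zero_nat _
  have h1 := (Complex.continuous_exp.tendsto 0).comp h
  rw [Complex.exp_zero] at h1
  exact h1

/-- The limit of the transform of the size of a failed trial. -/
theorem tendsto_one_sub_fail {p : ℕ → ℝ} (h : SquareRootDecay p) (hp : ∀ n, 0 ≤ p n)
    (hp0 : p 0 = 1) (s : ℝ) :
    Tendsto (fun n : ℕ => (1 - ∑ m ∈ Finset.range n,
      ((p m - p (m + 1) : ℝ) : ℂ) * Complex.exp (Complex.I * s / n) ^ m) / p n)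
      atTop (𝓝 (halfSymbol s)) := by
  -- By Abel summation the quotient equals `z ^ n - n (z - 1) * (∑ p (m + 1) z ^ m) / (n * p n)`
  -- with `z = exp (i s / n)`.
  have h1 := (tendsto_const_nhds (x := Complex.exp (Complex.I * s))).sub
    ((tendsto_mul_exp_sub_one s).mul (tendsto_sum_mul_exp h hp s))
  refine h1.congr' ?_
  filter_upwards [eventually_gt_atTop 0, h.eventually_pos] with n hn hpn
  have e1 : (n : ℂ) ≠ 0 := by exact_mod_cast hn.ne'
  have e2 : (p n : ℂ) ≠ 0 := by exact_mod_cast hpn.ne'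
  have h2 := sum_sub_succ_mul_pow (fun m => (p m : ℂ)) (Complex.exp (Complex.I * s / n)) n
  rw [exp_div_natCast_pow hn, hp0] at h2
  simp only [Complex.ofReal_sub]
  rw [h2]
  push_cast
  field_simp
  ring

/-! ### The limit distributions -/

instance isFiniteMeasure_convPower (μ : Measure ℝ) [IsFiniteMeasure μ] (k : ℕ) :
    IsFiniteMeasure (convPower μ k) := by
  induction k with
  | zero => rw [convPower]; infer_instance
  | succ k ih => rw [convPower]; infer_instance

theorem charFun_convPower (μ : Measure ℝ) [IsFiniteMeasure μ] (k : ℕ) (t : ℝ) :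
    charFun (convPower μ k) t = charFun μ t ^ k := by
  induction k with
  | zero => simp [convPower, charFun_dirac]
  | succ k ih => rw [convPower, charFun_conv, ih, pow_succ']

theorem convPower_univ (μ : Measure ℝ) [IsFiniteMeasure μ] (k : ℕ) :
    convPower μ k Set.univ = μ Set.univ ^ k := by
  induction k with
  | zero => simp [convPower]
  | succ k ih =>
    rw [convPower, Measure.conv, Measure.map_apply (by fun_prop) MeasurableSet.univ,
      Set.preimage_univ, ← Set.univ_prod_univ, Measure.prod_prod, ih, pow_succ']

theorem convPower_Iio (μ : Measure ℝ) [IsFiniteMeasure μ] (h : μ (Set.Iio 0) = 0) (k : ℕ) :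
    convPower μ k (Set.Iio 0) = 0 := by
  induction k with
  | zero => simp [convPower]
  | succ k ih =>
    rw [convPower, Measure.conv, Measure.map_apply (by fun_prop) measurableSet_Iio]
    refine measure_mono_null (t := Set.Iio 0 ×ˢ Set.univ ∪ Set.univ ×ˢ Set.Iio 0) ?_ ?_
    · rintro ⟨x, y⟩ hxy
      simp only [Set.mem_preimage, Set.mem_Iio, Set.mem_union, Set.mem_prod, Set.mem_univ,
        and_true, true_and] at hxy ⊢
      by_contra! hc
      linarith
    · rw [measure_union_null_iff, Measure.prod_prod, Measure.prod_prod, h, ih]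
      simp

section Mixture

variable (μ : Measure ℝ) [IsFiniteMeasure μ] (w : ℕ → ℝ) (e : ℕ → ℕ)

/-- The mixture of the convolution powers `e k` of `μ` with weights `w k`. -/
noncomputable def convMixture : Measure ℝ :=
  Measure.sum fun k => ENNReal.ofReal (w k) • convPower μ (e k)

variable {w e} (hw : ∀ k, 0 ≤ w k) (h1 : HasSum (fun k => w k * μ.real Set.univ ^ e k) 1)

include hw h1 in
theorem isProbabilityMeasure_convMixture : IsProbabilityMeasure (convMixture μ w e) := by
  constructor
  have hnn : ∀ k, 0 ≤ w k * μ.real Set.univ ^ e k := fun k =>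
    mul_nonneg (hw k) (pow_nonneg measureReal_nonneg _)
  rw [convMixture, Measure.sum_apply _ MeasurableSet.univ]
  rw [← ENNReal.ofReal_one, ← h1.tsum_eq, ENNReal.ofReal_tsum_of_nonneg hnn h1.summable]
  refine tsum_congr fun k => ?_
  rw [Measure.smul_apply, convPower_univ, smul_eq_mul, ENNReal.ofReal_mul (hw k),
    ENNReal.ofReal_pow measureReal_nonneg, ofReal_measureReal]

include hw h1 in
theorem hasSum_charFun_convMixture (t : ℝ) :
    HasSum (fun k => (w k : ℂ) * charFun μ t ^ e k) (charFun (convMixture μ w e) t) := by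
  have := isProbabilityMeasure_convMixture μ hw h1
  have hint : Integrable (fun x : ℝ => Complex.exp (t * x * Complex.I)) (convMixture μ w e) := by
    refine Integrable.of_bound (C := 1) (by fun_prop) (Eventually.of_forall fun x => ?_)
    rw [← Complex.ofReal_mul, Complex.norm_exp_ofReal_mul_I]
  have h2 := hasSum_integral_measure hint
  rw [charFun_apply_real (μ := convMixture μ w e)]
  refine h2.congr_fun fun k => ?_
  rw [integral_smul_measure, ← charFun_apply_real, charFun_convPower,
    ENNReal.toReal_ofReal (hw k), Complex.real_smul]

end Mixture

theorem convMixture_Iio (μ : Measure ℝ) [IsFiniteMeasure μ] (w : ℕ → ℝ) (e : ℕ → ℕ)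
    (h : μ (Set.Iio 0) = 0) : convMixture μ w e (Set.Iio 0) = 0 := by
  rw [convMixture, Measure.sum_apply _ measurableSet_Iio, ENNReal.tsum_eq_zero]
  intro k
  rw [Measure.smul_apply, convPower_Iio μ h, smul_zero]

/-- The law of the size of a failed trial, divided by `n`. -/
noncomputable def failLaw (p : ℕ → ℝ) (n : ℕ) : Measure ℝ :=
  ∑ m ∈ Finset.range n, ENNReal.ofReal (p m - p (m + 1)) • Measure.dirac ((m : ℝ) / n)

instance (p : ℕ → ℝ) (n : ℕ) : IsFiniteMeasure (failLaw p n) := by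
  rw [failLaw]
  have : ∀ m, IsFiniteMeasure
      (ENNReal.ofReal (p m - p (m + 1)) • Measure.dirac ((m : ℝ) / n)) := fun m =>
    Measure.smul_finite _ ENNReal.ofReal_ne_top
  infer_instance

theorem failLaw_Iio (p : ℕ → ℝ) (n : ℕ) : failLaw p n (Set.Iio 0) = 0 := by
  rw [failLaw, Measure.finsetSum_apply]
  refine Finset.sum_eq_zero fun m _ => ?_
  rw [Measure.smul_apply, Measure.dirac_apply' _ measurableSet_Iio, Set.indicator_of_notMem,
    smul_zero]
  rw [Set.mem_Iio, not_lt]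
  positivity

theorem charFun_failLaw {p : ℕ → ℝ} (hp : Antitone p) (n : ℕ) (s : ℝ) :
    charFun (failLaw p n) s = ∑ m ∈ Finset.range n,
      ((p m - p (m + 1) : ℝ) : ℂ) * Complex.exp (Complex.I * s / n) ^ m := by
  rw [charFun_apply_real, failLaw, integral_finsetSum_measure]
  · refine Finset.sum_congr rfl fun m _ => ?_
    rw [integral_smul_measure, integral_dirac, ENNReal.toReal_ofReal
      (sub_nonneg.2 (hp (Nat.le_succ m))), Complex.real_smul, ← Complex.exp_nat_mul]
    congr 2
    push_cast
    ring
  · intro m _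
    exact (integrable_dirac (by simp)).smul_measure ENNReal.ofReal_ne_top

theorem failLaw_real_univ {p : ℕ → ℝ} (hp : Antitone p) (n : ℕ) :
    (failLaw p n).real Set.univ = p 0 - p n := by
  have h := charFun_failLaw hp n 0
  rw [charFun_zero] at h
  simp only [Complex.ofReal_zero, mul_zero, zero_div, Complex.exp_zero, one_pow, mul_one] at h
  rw [← Complex.ofReal_sum, Finset.sum_range_sub'] at h
  exact_mod_cast h

theorem norm_charFun_failLaw_le {p : ℕ → ℝ} (hp : Antitone p) (n : ℕ) (s : ℝ) :
    ‖charFun (failLaw p n) s‖ ≤ p 0 - p n := by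
  rw [← failLaw_real_univ hp]
  exact norm_charFun_le s

/-- Continuity at 0 is what turns convergence of transforms into tightness. -/
theorem continuousAt_halfSymbol_zero : ContinuousAt halfSymbol 0 := by
  have hb : ∀ s : ℝ, ‖sqrtTransform s‖ ≤ Real.exp |s| * 2 := by
    intro s
    have h1 := (NormedSpace.expSeries_div_hasSum_exp (𝔸 := ℝ) |s|).mul_right 2
    rw [← Real.exp_eq_exp_ℝ] at h1
    refine tsum_of_norm_bounded h1 fun k => ?_
    rw [norm_mul, norm_div, norm_pow, norm_mul, Complex.norm_I, one_mul, Complex.norm_real,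
      Real.norm_eq_abs, Complex.norm_natCast]
    gcongr
    rw [norm_div, norm_one, show ((k : ℂ) + 1 / 2) = ((k + 1 / 2 : ℝ) : ℂ) by push_cast; ring,
      Complex.norm_real, Real.norm_eq_abs, abs_of_pos (by positivity)]
    rw [div_le_iff₀ (by positivity)]
    have : (0 : ℝ) ≤ k := by positivity
    linarith
  have h0 : halfSymbol 0 = 1 := by simp [halfSymbol]
  rw [ContinuousAt, h0]
  have h1 : Tendsto (fun s : ℝ => Complex.I * s * sqrtTransform s) (𝓝 0) (𝓝 0) := by
    have h2 : Tendsto (fun s : ℝ => |s| * (Real.exp |s| * 2)) (𝓝 0) (𝓝 0) := by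
      have : Continuous fun s : ℝ => |s| * (Real.exp |s| * 2) := by fun_prop
      simpa using this.tendsto 0
    refine squeeze_zero_norm (fun s => ?_) h2
    rw [norm_mul, norm_mul, Complex.norm_I, one_mul, Complex.norm_real, Real.norm_eq_abs]
    gcongr
    exact hb s
  have h3 : Tendsto (fun s : ℝ => Complex.exp (Complex.I * s)) (𝓝 0) (𝓝 1) := by
    have : Continuous fun s : ℝ => Complex.exp (Complex.I * s) := by fun_prop
    simpa using this.tendsto 0
  have h4 := h3.sub h1
  rw [sub_zero] at h4
  exact h4

/-- A survival function with square root decay. -/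
noncomputable def sqrtSurvival (n : ℕ) : ℝ := ((max n 1 : ℕ) : ℝ) ^ (-(1 / 2) : ℝ)

theorem sqrtSurvival_pos (n : ℕ) : 0 < sqrtSurvival n := by
  rw [sqrtSurvival]
  have : (0 : ℝ) < ((max n 1 : ℕ) : ℝ) := by exact_mod_cast lt_max_of_lt_right one_pos
  positivity

theorem antitone_sqrtSurvival : Antitone sqrtSurvival := by
  intro m n hmn
  have : (0 : ℝ) < ((max m 1 : ℕ) : ℝ) := by exact_mod_cast lt_max_of_lt_right one_pos
  refine Real.rpow_le_rpow_of_nonpos this ?_ (by norm_num)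
  exact_mod_cast max_le_max hmn le_rfl

theorem sqrtSurvival_zero : sqrtSurvival 0 = 1 := by simp [sqrtSurvival]

theorem squareRootDecay_sqrtSurvival : SquareRootDecay sqrtSurvival := by
  refine ⟨1, one_pos, Filter.EventuallyEq.isEquivalent ?_⟩
  filter_upwards [eventually_ge_atTop 1] with n hn
  rw [sqrtSurvival, max_eq_left hn, one_mul]

/-- The law of a failed trial has mass `1 - p n`, so its transform `φ` satisfies `Re (1 - φ) ≥ p n`.
The bound survives division by `p n` and the limit. Any survival function with square root decay
would serve; `sqrtSurvival` is an explicit one. -/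
theorem one_le_re_halfSymbol (s : ℝ) : 1 ≤ (halfSymbol s).re := by
  have h := tendsto_one_sub_fail squareRootDecay_sqrtSurvival (fun n => (sqrtSurvival_pos n).le)
    sqrtSurvival_zero s
  refine ge_of_tendsto' ((Complex.continuous_re.tendsto _).comp h) fun n => ?_
  have h1 := norm_charFun_failLaw_le antitone_sqrtSurvival n s
  have h2 := (Complex.re_le_norm _).trans h1
  rw [charFun_failLaw antitone_sqrtSurvival, sqrtSurvival_zero] at h2
  rw [Function.comp, Complex.div_ofReal_re, le_div_iff₀ (sqrtSurvival_pos n), Complex.sub_re,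
    Complex.one_re]
  linarith

theorem halfSymbol_ne_zero (s : ℝ) : halfSymbol s ≠ 0 := by
  intro h
  have := one_le_re_halfSymbol s
  rw [h, Complex.zero_re] at this
  linarith

/-- Let `ρ n` be the law of the rescaled total size of the failed trials before the first one that
reaches `n`: a geometric mixture with transform `p n / (1 - φ)`, where `φ` is the transform of
`failLaw p n`. It converges to `1 / H`, which is continuous at 0, so the `ρ n` are tight, and any
cluster point is the desired law. -/
theorem exists_isDarlingMandelbrot_half : ∃ μ : ProbabilityMeasure ℝ,
    IsDarlingMandelbrot (1 / 2) μ := by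
  set p := sqrtSurvival with hp
  have hp1 : ∀ n, p n ≤ 1 := fun n =>
    sqrtSurvival_zero ▸ antitone_sqrtSurvival (Nat.zero_le n)
  have hgeom : ∀ n, HasSum (fun k : ℕ => p n * (failLaw p n).real Set.univ ^ k) 1 := by
    intro n
    have hpos := sqrtSurvival_pos n
    rw [failLaw_real_univ antitone_sqrtSurvival, hp, sqrtSurvival_zero]
    have := (hasSum_geometric_of_lt_one (sub_nonneg.2 (hp1 n)) (by linarith)).mul_left (p n)
    rwa [sub_sub_cancel, mul_inv_cancel₀ hpos.ne'] at this
  have hw : ∀ n (k : ℕ), 0 ≤ p n := fun n k => (sqrtSurvival_pos n).le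
  let ρ : ℕ → ProbabilityMeasure ℝ := fun n =>
    ⟨convMixture (failLaw p n) (fun _ => p n) id,
      isProbabilityMeasure_convMixture _ (hw n) (hgeom n)⟩
  have hchar : ∀ s, Tendsto (fun n => charFun (ρ n : Measure ℝ) s) atTop
      (𝓝 (halfSymbol s)⁻¹) := by
    intro s
    have h := tendsto_one_sub_fail squareRootDecay_sqrtSurvival
      (fun n => (sqrtSurvival_pos n).le) sqrtSurvival_zero s
    refine (h.inv₀ (halfSymbol_ne_zero s)).congr fun n => ?_
    have hpos := sqrtSurvival_pos n
    have h2 := hasSum_charFun_convMixture _ (hw n) (hgeom n) s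
    have h3 := norm_charFun_failLaw_le antitone_sqrtSurvival n s
    rw [sqrtSurvival_zero] at h3
    have h4 := (hasSum_geometric_of_norm_lt_one (lt_of_le_of_lt h3 (by linarith))).mul_left
      (p n : ℂ)
    rw [← charFun_failLaw antitone_sqrtSurvival]
    change _ = charFun (convMixture (failLaw p n) (fun _ => p n) fun k => k) s
    rw [← h4.unique h2, inv_div, div_eq_mul_inv]
  have htight : IsTightMeasureSet (Set.range fun n => (ρ n : Measure ℝ)) :=
    isTightMeasureSet_of_tendsto_charFun
      (continuousAt_halfSymbol_zero.inv₀ (halfSymbol_ne_zero 0)) hchar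
  have hcomp : IsCompact (closure (Set.range ρ)) := by
    refine isCompact_closure_of_isTightMeasureSet ?_
    convert htight using 1
    ext x
    simp
  obtain ⟨μ, -, hμ⟩ := hcomp.exists_mapClusterPt (f := atTop) (u := ρ)
    (tendsto_principal.2 (Eventually.of_forall fun n => subset_closure ⟨n, rfl⟩))
  obtain ⟨U, hU, hUμ⟩ := mapClusterPt_iff_ultrafilter.1 hμ
  refine ⟨μ, ?_, fun s => ?_⟩
  -- By the portmanteau theorem, the open half-line remains null in the limit.
  · have h1 := ProbabilityMeasure.le_liminf_measure_open_of_tendsto hUμ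
      (isOpen_Iio (a := (0 : ℝ)))
    have h2 : ∀ n, (ρ n : Measure ℝ) (Set.Iio 0) = 0 := fun n =>
      convMixture_Iio _ _ _ (failLaw_Iio p n)
    simp only [h2, liminf_const] at h1
    exact le_antisymm h1 zero_le
  · rw [← halfSymbol_eq]
    rw [ProbabilityMeasure.tendsto_iff_forall_integral_rclike_tendsto ℂ] at hUμ
    have h1 : Tendsto (fun n => charFun (ρ n : Measure ℝ) s) U (𝓝 (charFun (μ : Measure ℝ) s)) := by
      simp_rw [charFun_eq_integral_innerProbChar]
      exact hUμ (BoundedContinuousFunction.innerProbChar s)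
    exact tendsto_nhds_unique h1 ((hchar s).mono_left hU)

/-- The transform of the cost law is the limit of the transforms of the rescaled costs. -/
theorem exists_isDarlingMandelbrotSum : ∃ ν : ProbabilityMeasure ℝ,
    IsDarlingMandelbrotSum (1 / 2) (3 / 4) ν ∧ ∀ s : ℝ, charFun (ν : Measure ℝ) s =
      3 / 4 * Complex.exp (Complex.I * s) /
        (halfSymbol s - 1 / 4 * Complex.exp (Complex.I * s)) := by
  obtain ⟨μ, hμ⟩ := exists_isDarlingMandelbrot_half
  let μ' : Measure ℝ := (μ : Measure ℝ).map fun x => 1 + x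
  have hμ' : IsProbabilityMeasure μ' := Measure.isProbabilityMeasure_map (by fun_prop)
  have hw : ∀ k : ℕ, (0 : ℝ) ≤ (1 - 3 / 4) ^ k * (3 / 4) := fun k => by norm_num
  have h1 : HasSum (fun k : ℕ => ((1 : ℝ) - 3 / 4) ^ k * (3 / 4) *
      μ'.real Set.univ ^ (k + 1)) 1 := by
    simp only [probReal_univ, one_pow, mul_one]
    have := (hasSum_geometric_of_lt_one (r := (1 : ℝ) - 3 / 4) (by norm_num)
      (by norm_num)).mul_right (3 / 4)
    norm_num at this ⊢
    exact this
  refine ⟨⟨convMixture μ' (fun k => (1 - 3 / 4) ^ k * (3 / 4)) (fun k => k + 1),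
    isProbabilityMeasure_convMixture _ hw h1⟩, ⟨μ, hμ, rfl⟩, fun s => ?_⟩
  have h2 := hasSum_charFun_convMixture _ hw h1 s
  have h3 : charFun μ' s = Complex.exp (Complex.I * s) / halfSymbol s := by
    rw [charFun_map_const_add, hμ.2 s, ← halfSymbol_eq, div_eq_mul_inv, mul_comm]
    congr 2
    simp [mul_comm]
  -- The geometric series has ratio `charFun μ' s / 4`, of norm at most 1/4.
  have h4 : ‖(1 / 4 : ℂ) * charFun μ' s‖ < 1 := by
    rw [norm_mul]
    have := norm_charFun_le_one (μ := μ') s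
    norm_num
    linarith
  have h5 := (hasSum_geometric_of_norm_lt_one h4).mul_left (3 / 4 * charFun μ' s)
  have h6 : charFun (convMixture μ' (fun k => (1 - 3 / 4) ^ k * (3 / 4)) (fun k => k + 1)) s =
      3 / 4 * charFun μ' s * (1 - 1 / 4 * charFun μ' s)⁻¹ := by
    refine h2.unique (h5.congr_fun fun k => ?_)
    push_cast
    rw [mul_pow, pow_succ]
    norm_num
    ring
  change charFun (convMixture _ _ _) s = _
  rw [h6, h3]
  have h7 := halfSymbol_ne_zero s
  rw [show halfSymbol s - 1 / 4 * Complex.exp (Complex.I * s) =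
    halfSymbol s * (1 - 1 / 4 * (Complex.exp (Complex.I * s) / halfSymbol s)) by field_simp,
    ← div_div, ← div_eq_mul_inv]
  ring

/-! ### The cost of independent trials -/

instance : DiscreteMeasurableSpace UBTree := ⟨fun _ => MeasurableSpace.measurableSet_top⟩

theorem sInf_eq_of_forall_lt {P : ℕ → Prop} {k : ℕ} (hk : P k) (h : ∀ j < k, ¬ P j) :
    sInf {i | P i} = k :=
  le_antisymm (Nat.sInf_le hk) (le_csInf ⟨k, hk⟩ fun j hj => by
    by_contra hlt
    exact h j (not_le.1 hlt) hj)

theorem measurable_numNodes_apply (i : ℕ) :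
    Measurable fun t : ℕ → UBTree => (t i).numNodes :=
  (Measurable.of_discrete (f := UBTree.numNodes)).comp (measurable_pi_apply i)

theorem measurable_sInf_numNodes (n : ℕ) :
    Measurable fun t : ℕ → UBTree => sInf {i | (t i).numNodes = n} := by
  have hP : ∀ i, MeasurableSet {t : ℕ → UBTree | (t i).numNodes = n} := fun i =>
    measurable_numNodes_apply i (measurableSet_singleton n)
  have hsucc : ∀ k, MeasurableSet {t : ℕ → UBTree | (t k).numNodes = n ∧
      ∀ j < k, (t j).numNodes ≠ n} := fun k => by
    have : {t : ℕ → UBTree | (t k).numNodes = n ∧ ∀ j < k, (t j).numNodes ≠ n} =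
        {t | (t k).numNodes = n} ∩ ⋂ j, ⋂ _ : j < k, {t | (t j).numNodes = n}ᶜ := by
      ext t
      simp
    rw [this]
    exact (hP k).inter (MeasurableSet.iInter fun j => MeasurableSet.iInter fun _ => (hP j).compl)
  refine measurable_to_countable' fun k => ?_
  rcases Nat.eq_zero_or_pos k with rfl | hk
  -- Since `sInf ∅ = 0`, the fibre over 0 also contains the sequences without any success.
  · have : (fun t : ℕ → UBTree => sInf {i | (t i).numNodes = n}) ⁻¹' {0} =
        {t | (t 0).numNodes = n} ∪ (⋃ k, {t | (t k).numNodes = n})ᶜ := by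
      ext t
      simp only [Set.mem_preimage, Set.mem_singleton_iff, Nat.sInf_eq_zero, Set.mem_union,
        Set.mem_compl_iff, Set.mem_iUnion, Set.mem_ofPred_eq, not_exists]
      rw [Set.eq_empty_iff_forall_notMem]
      rfl
    rw [this]
    exact (hP 0).union (MeasurableSet.iUnion hP).compl
  · convert hsucc k using 1
    ext t
    simp only [Set.mem_preimage, Set.mem_singleton_iff, Set.mem_ofPred_eq]
    constructor
    · intro h
      have hne : {i | (t i).numNodes = n}.Nonempty := by
        by_contra hc
        rw [Set.not_nonempty_iff_eq_empty.1 hc, Nat.sInf_empty] at h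
        omega
      refine ⟨h ▸ Nat.sInf_mem hne, fun j hj hj' => ?_⟩
      have := Nat.sInf_le (show j ∈ {i | (t i).numNodes = n} from hj')
      omega
    · rintro ⟨h1, h2⟩
      exact sInf_eq_of_forall_lt h1 h2

theorem measurable_nodesBuilt (n : ℕ) : Measurable (nodesBuilt n) := by
  have h : Measurable fun q : ℕ × (ℕ → UBTree) =>
      ∑ i ∈ Finset.range (q.1 + 1), (q.2 i).numNodes := by
    refine measurable_from_prod_countable_right fun k => ?_
    change Measurable fun t : ℕ → UBTree => ∑ i ∈ Finset.range (k + 1), (t i).numNodes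
    exact Finset.measurable_fun_sum _ fun i _ => measurable_numNodes_apply i
  exact h.comp ((measurable_sInf_numNodes n).prodMk measurable_id)

theorem nodesBuilt_eq {n k : ℕ} {t : ℕ → UBTree} (hk : (t k).numNodes = n)
    (h : ∀ j < k, (t j).numNodes ≠ n) :
    nodesBuilt n t = ∑ i ∈ Finset.range (k + 1), (t i).numNodes := by
  rw [nodesBuilt, sInf_eq_of_forall_lt (P := fun i => (t i).numNodes = n) hk h]

/-- Monotone convergence in a form that also yields integrability of the limit. -/
theorem integrable_and_integral_eq_of_monotone {Ω : Type*} [MeasurableSpace Ω] {P : Measure Ω}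
    {f : ℕ → Ω → ℝ} {F : Ω → ℝ} {L : ℝ} (hf : ∀ k, Integrable (f k) P)
    (h0 : ∀ k ω, 0 ≤ f k ω) (hmono : ∀ ω, Monotone fun k => f k ω)
    (hF : ∀ᵐ ω ∂P, Tendsto (fun k => f k ω) atTop (𝓝 (F ω)))
    (hL : Tendsto (fun k => ∫ ω, f k ω ∂P) atTop (𝓝 L)) :
    Integrable F P ∧ ∫ ω, F ω ∂P = L := by
  have h1 : Tendsto (fun k => ∫⁻ ω, ENNReal.ofReal (f k ω) ∂P) atTop
      (𝓝 (∫⁻ ω, ENNReal.ofReal (F ω) ∂P)) := by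
    refine lintegral_tendsto_of_tendsto_of_monotone
      (fun k => (hf k).aestronglyMeasurable.aemeasurable.ennreal_ofReal)
      (Eventually.of_forall fun ω k l hkl => ENNReal.ofReal_le_ofReal (hmono ω hkl)) ?_
    filter_upwards [hF] with ω hω
    exact (ENNReal.continuous_ofReal.tendsto _).comp hω
  have h2 : ∀ k, ∫⁻ ω, ENNReal.ofReal (f k ω) ∂P = ENNReal.ofReal (∫ ω, f k ω ∂P) := fun k =>
    (ofReal_integral_eq_lintegral_ofReal (hf k) (Eventually.of_forall (h0 k))).symm
  simp only [h2] at h1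
  have h3 := tendsto_nhds_unique h1 ((ENNReal.continuous_ofReal.tendsto L).comp hL)
  have hF0 : 0 ≤ᵐ[P] F := by
    filter_upwards [hF] with ω hω
    exact ge_of_tendsto' hω fun k => h0 k ω
  have hFm : AEStronglyMeasurable F P :=
    aestronglyMeasurable_of_tendsto_ae _ (fun k => (hf k).aestronglyMeasurable) hF
  have hL0 : 0 ≤ L := ge_of_tendsto' hL fun k => integral_nonneg (h0 k)
  refine ⟨⟨hFm, ?_⟩, ?_⟩
  · rw [hasFiniteIntegral_iff_ofReal hF0, h3]
    exact ENNReal.ofReal_lt_top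
  · rw [integral_eq_lintegral_of_nonneg_ae hF0 hFm, h3, ENNReal.toReal_ofReal hL0]

section IndependentTrials

variable {Ω : Type*} [MeasurableSpace Ω] {P : Measure Ω} {X : ℕ → Ω → UBTree}
  {τ : Measure UBTree}

theorem integral_prod_range {𝕜 : Type*} [RCLike 𝕜] (hX : iIndepFun X P)
    (hlaw : ∀ i, HasLaw (X i) τ P) (f : ℕ → UBTree → 𝕜) (k : ℕ) :
    ∫ ω, ∏ i ∈ Finset.range k, f i (X i ω) ∂P = ∏ i ∈ Finset.range k, ∫ t, f i t ∂τ := by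
  have hs : ∀ i (μ : Measure UBTree), AEStronglyMeasurable (f i) μ := fun i μ =>
    (Measurable.of_discrete (f := f i)).aestronglyMeasurable
  have h := (hX.precomp (g := ((↑) : Fin k → ℕ)) Fin.val_injective).integral_fun_prod_comp
    (X := fun i : Fin k => X i) (f := fun i : Fin k => f i) (fun i => (hlaw i).aemeasurable) (fun i => hs i _)
  simp only [Finset.prod_range, h]
  refine Finset.prod_congr rfl fun i _ => ?_
  rw [← (hlaw i).map_eq, integral_map (hlaw i).aemeasurable (hs i _)]

variable [IsProbabilityMeasure τ] (hX : iIndepFun X P) (hlaw : ∀ i, HasLaw (X i) τ P) {n : ℕ}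

/-- The indicator function of the trees of size different from `n`. -/
noncomputable def missInd (n : ℕ) (t : UBTree) : ℝ := if t.numNodes = n then 0 else 1

theorem missInd_nonneg (n : ℕ) (t : UBTree) : 0 ≤ missInd n t := by
  rw [missInd]; split_ifs <;> norm_num

theorem missInd_le_one (n : ℕ) (t : UBTree) : missInd n t ≤ 1 := by
  rw [missInd]; split_ifs <;> norm_num

theorem missInd_mul_self (n : ℕ) (t : UBTree) : missInd n t * missInd n t = missInd n t := by
  rw [missInd]; split_ifs <;> norm_num

theorem integral_missInd (n : ℕ) :
    ∫ t, missInd n t ∂τ = 1 - τ.real {t | t.numNodes = n} := by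
  have h : missInd n = {t : UBTree | t.numNodes = n}ᶜ.indicator 1 := by
    ext t
    by_cases h : t.numNodes = n <;> simp [missInd, h]
  rw [h, integral_indicator_one MeasurableSet.of_discrete,
    probReal_compl_eq_one_sub MeasurableSet.of_discrete]

include hX hlaw in
-- The first `k` trials all miss with probability `(1 - s) ^ k`, which tends to 0. The bound is
-- Markov's inequality for the product of the `missInd`.
theorem ae_exists_success (hs : 0 < τ.real {t | t.numNodes = n}) :
    ∀ᵐ ω ∂P, ∃ i, (X i ω).numNodes = n := by
  have := hX.isProbabilityMeasure
  obtain ⟨q, hq⟩ : ∃ q, q = ∫ t, missInd n t ∂τ := ⟨_, rfl⟩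
  have hq1 : q < 1 := by rw [hq, integral_missInd]; linarith
  have hq0 : 0 ≤ q := by rw [hq]; exact integral_nonneg (missInd_nonneg n)
  have h1 : ∀ k : ℕ, (P {ω | ¬ ∃ i, (X i ω).numNodes = n}) ≤ ENNReal.ofReal (q ^ k) := by
    intro k
    have h2 := integral_prod_range hX hlaw (fun _ => missInd n) k
    rw [Finset.prod_const, Finset.card_range, ← hq] at h2
    rw [← h2]
    have hm : AEMeasurable (fun ω => ∏ i ∈ Finset.range k, missInd n (X i ω)) P :=
      Finset.aemeasurable_fun_prod _ fun i _ =>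
        (Measurable.of_discrete (f := missInd n)).comp_aemeasurable (hlaw i).aemeasurable
    have hnn : ∀ ω, 0 ≤ ∏ i ∈ Finset.range k, missInd n (X i ω) := fun ω =>
      Finset.prod_nonneg fun i _ => missInd_nonneg n _
    rw [ofReal_integral_eq_lintegral_ofReal _ (Eventually.of_forall hnn)]
    · have h3 := mul_meas_ge_le_lintegral₀ (μ := P) hm.ennreal_ofReal 1
      rw [one_mul] at h3
      refine le_trans (measure_mono ?_) h3
      intro ω hω
      simp only [Set.mem_ofPred_eq, not_exists] at hω ⊢
      simp [missInd, hω]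
    · refine Integrable.of_bound hm.aestronglyMeasurable 1 (Eventually.of_forall fun ω => ?_)
      rw [Real.norm_eq_abs, abs_of_nonneg (hnn ω)]
      exact Finset.prod_le_one (fun i _ => missInd_nonneg n _) fun i _ => missInd_le_one n _
  have h4 : Tendsto (fun k : ℕ => ENNReal.ofReal (q ^ k)) atTop (𝓝 0) := by
    have := (ENNReal.continuous_ofReal.tendsto 0).comp (tendsto_pow_atTop_nhds_zero_of_lt_one hq0 hq1)
    rwa [ENNReal.ofReal_zero] at this
  exact le_antisymm (ge_of_tendsto' h4 h1) zero_le

include hX hlaw in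
/-- The transform of the cost of the trials up to the first success. -/
theorem integral_exp_nodesBuilt (hs : 0 < τ.real {t | t.numNodes = n}) (z : ℂ) (hz : ‖z‖ = 1) :
    ∫ ω, z ^ nodesBuilt n (fun i => X i ω) ∂P =
      τ.real {t | t.numNodes = n} * z ^ n /
        (1 - ∫ t, (missInd n t : ℂ) * z ^ t.numNodes ∂τ) := by
  have := hX.isProbabilityMeasure
  obtain ⟨s, hs'⟩ : ∃ s, s = τ.real {t | t.numNodes = n} := ⟨_, rfl⟩
  rw [← hs'] at hs ⊢
  have hs1 : s ≤ 1 := hs' ▸ measureReal_le_one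
  have hint1 : ∫ t, (1 - missInd n t) ∂τ = s := by
    rw [integral_sub (integrable_const 1), integral_missInd, ← hs']
    · simp
    · exact Integrable.of_bound (Measurable.of_discrete).aestronglyMeasurable 1
        (Eventually.of_forall fun t => by
          rw [Real.norm_eq_abs, abs_of_nonneg (missInd_nonneg n t)]; exact missInd_le_one n t)
  set g : UBTree → ℂ := fun t => (missInd n t : ℂ) * z ^ t.numNodes with hg
  set h : UBTree → ℂ := fun t => ((1 - missInd n t : ℝ) : ℂ) * z ^ t.numNodes with hh
  have hgn : ∀ t, ‖g t‖ = missInd n t := fun t => by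
    rw [hg, norm_mul, norm_pow, hz, one_pow, mul_one, Complex.norm_real, Real.norm_eq_abs,
      abs_of_nonneg (missInd_nonneg n t)]
  have hhn : ∀ t, ‖h t‖ = 1 - missInd n t := fun t => by
    rw [hh, norm_mul, norm_pow, hz, one_pow, mul_one, Complex.norm_real, Real.norm_eq_abs,
      abs_of_nonneg (sub_nonneg.2 (missInd_le_one n t))]
  have hg_int : ‖∫ t, g t ∂τ‖ ≤ 1 - s := by
    refine (norm_integral_le_integral_norm _).trans_eq ?_
    simp only [hgn]
    rw [integral_missInd, hs']
  have hh_int : ∫ t, h t ∂τ = s * z ^ n := by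
    have : ∀ t, h t = ((1 - missInd n t : ℝ) : ℂ) * z ^ n := by
      intro t
      simp only [hh]
      by_cases ht : t.numNodes = n <;> simp [missInd, ht]
    simp only [this]
    rw [integral_mul_const, integral_complex_ofReal, hint1]
  -- `F k` is `z` to the cost on the event that the first success is trial `k`, and 0 elsewhere. It
  -- is a product of functions of the single trials: `g` for a miss, `h` for the success.
  set F : ℕ → Ω → ℂ := fun k ω => ∏ i ∈ Finset.range (k + 1),
    (if i < k then g else h) (X i ω) with hF
  have hFint : ∀ k, ∫ ω, F k ω ∂P = (∫ t, g t ∂τ) ^ k * (s * z ^ n) := by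
    intro k
    rw [hF, integral_prod_range hX hlaw (fun i => if i < k then g else h), Finset.prod_range_succ,
      if_neg (lt_irrefl k), hh_int]
    congr 1
    rw [Finset.prod_congr rfl (g := fun _ => ∫ t, g t ∂τ), Finset.prod_const, Finset.card_range]
    intro i hi
    rw [if_pos (Finset.mem_range.1 hi)]
  have hFnorm : ∀ k, ∫ ω, ‖F k ω‖ ∂P = (1 - s) ^ k * s := by
    intro k
    have : ∀ ω, ‖F k ω‖ = ∏ i ∈ Finset.range (k + 1),
        (if i < k then missInd n else fun t => 1 - missInd n t) (X i ω) := by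
      intro ω
      rw [hF, norm_prod]
      refine Finset.prod_congr rfl fun i _ => ?_
      split_ifs
      · exact hgn _
      · exact hhn _
    simp only [this]
    rw [integral_prod_range hX hlaw (fun i => if i < k then missInd n else fun t => 1 - missInd n t),
      Finset.prod_range_succ, if_neg (lt_irrefl k), hint1]
    congr 1
    rw [Finset.prod_congr rfl (g := fun _ => 1 - s), Finset.prod_const, Finset.card_range]
    intro i hi
    rw [if_pos (Finset.mem_range.1 hi), integral_missInd, hs']
  have hFm : ∀ k, AEStronglyMeasurable (F k) P := fun k =>
    (Finset.aemeasurable_fun_prod _ fun i _ =>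
      (Measurable.of_discrete (f := if i < k then g else h)).comp_aemeasurable
        (hlaw i).aemeasurable).aestronglyMeasurable
  have hFi : ∀ k, Integrable (F k) P := fun k => by
    refine Integrable.of_bound (hFm k) 1 (Eventually.of_forall fun ω => ?_)
    rw [hF, norm_prod]
    refine Finset.prod_le_one (fun i _ => norm_nonneg _) fun i _ => ?_
    split_ifs
    · rw [hgn]; exact missInd_le_one n _
    · rw [hhn]; linarith [missInd_nonneg n (X i ω)]
  have hsum : Summable fun k => ∫ ω, ‖F k ω‖ ∂P := by
    simp only [hFnorm]
    exact (summable_geometric_of_lt_one (by linarith) (by linarith)).mul_right s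
  have hkey := hasSum_integral_of_summable_integral_norm hFi hsum
  have hpt : ∀ᵐ ω ∂P, ∑' k, F k ω = z ^ nodesBuilt n (fun i => X i ω) := by
    filter_upwards [ae_exists_success hX hlaw (hs' ▸ hs)] with ω hω
    classical
    obtain ⟨N, hN, hlt⟩ : ∃ N, (X N ω).numNodes = n ∧ ∀ j < N, (X j ω).numNodes ≠ n :=
      ⟨Nat.find hω, Nat.find_spec hω, fun j hj => Nat.find_min hω hj⟩
    rw [nodesBuilt_eq hN hlt, tsum_eq_single N]
    · rw [hF, ← Finset.prod_pow_eq_pow_sum]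
      refine Finset.prod_congr rfl fun i hi => ?_
      split_ifs with hi'
      · simp [hg, missInd, hlt i hi']
      · have : i = N := by have := Finset.mem_range.1 hi; omega
        subst this
        simp [hh, missInd, hN]
    · intro k hk
      rcases lt_or_gt_of_ne hk with hk | hk
      · refine Finset.prod_eq_zero (Finset.self_mem_range_succ k) ?_
        simp [hh, missInd, hlt k hk]
      · refine Finset.prod_eq_zero (i := N) (Finset.mem_range.2 (by omega)) ?_
        simp [hk, hg, missInd, hN]
  rw [← integral_congr_ae hpt]
  simp only [hFint] at hkey
  have hgeo := (hasSum_geometric_of_norm_lt_one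
    (lt_of_le_of_lt hg_int (by linarith))).mul_right (s * z ^ n)
  rw [hkey.unique hgeo, div_eq_mul_inv, mul_comm]

end IndependentTrials

/-! ### First and second moments of the cost. -/

section Moments

variable {Ω : Type*} {X : ℕ → Ω → UBTree}

/-- The size of the `i`-th tree, if it is built before the first success. -/
noncomputable def costTerm (X : ℕ → Ω → UBTree) (n i : ℕ) (ω : Ω) : ℝ :=
  (∏ j ∈ Finset.range i, missInd n (X j ω)) * ((X i ω).numNodes : ℝ)

theorem costTerm_nonneg (n i : ℕ) (ω : Ω) : 0 ≤ costTerm X n i ω :=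
  mul_nonneg (Finset.prod_nonneg fun _ _ => missInd_nonneg n _) (Nat.cast_nonneg _)

theorem sum_costTerm {n N k : ℕ} {ω : Ω} (hN : (X N ω).numNodes = n)
    (hlt : ∀ j < N, (X j ω).numNodes ≠ n) (hk : N < k) :
    ∑ i ∈ Finset.range k, costTerm X n i ω = nodesBuilt n fun i => X i ω := by
  rw [nodesBuilt_eq hN hlt, Nat.cast_sum, ← Finset.sum_subset (Finset.range_subset_range.2 hk)]
  · refine Finset.sum_congr rfl fun i hi => ?_
    rw [costTerm, Finset.prod_eq_one, one_mul]
    intro j hj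
    rw [missInd, if_neg (hlt j _)]
    have := Finset.mem_range.1 hi
    have := Finset.mem_range.1 hj
    omega
  · intro i _ hi
    rw [costTerm, Finset.prod_eq_zero (i := N), zero_mul]
    · simp only [Finset.mem_range] at hi ⊢; omega
    · rw [missInd, if_pos hN]

/-- As `missInd` is idempotent, the misses required by the term `i` are absorbed in those required
by the term `j`. Trial `i` contributes its size times its miss, which gives a product over
independent trials. -/
theorem costTerm_mul_costTerm (n : ℕ) {i j : ℕ} (hij : i < j) (ω : Ω) :
    costTerm X n i ω * costTerm X n j ω = ∏ l ∈ Finset.range (j + 1),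
      (if l < j then fun t : UBTree => (if l = i then (t.numNodes : ℝ) else 1) * missInd n t
        else fun t => (t.numNodes : ℝ)) (X l ω) := by
  rw [Finset.prod_range_succ, if_neg (lt_irrefl j)]
  rw [Finset.prod_congr rfl (g := fun l =>
    (if l = i then ((X l ω).numNodes : ℝ) else 1) * missInd n (X l ω)) (fun l hl => by
      rw [if_pos (Finset.mem_range.1 hl)])]
  rw [Finset.prod_mul_distrib, Finset.prod_ite_eq' , if_pos (Finset.mem_range.2 hij)]
  have h : (∏ l ∈ Finset.range i, missInd n (X l ω)) * ∏ l ∈ Finset.range j, missInd n (X l ω) =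
      ∏ l ∈ Finset.range j, missInd n (X l ω) := by
    rw [← Finset.prod_range_mul_prod_Ico _ hij.le, ← mul_assoc, ← Finset.prod_mul_distrib]
    simp only [missInd_mul_self]
  rw [costTerm, costTerm]
  calc _ = ((X i ω).numNodes : ℝ) * ((∏ l ∈ Finset.range i, missInd n (X l ω)) *
        ∏ l ∈ Finset.range j, missInd n (X l ω)) * ((X j ω).numNodes : ℝ) := by ring
    _ = _ := by rw [h]

variable [MeasurableSpace Ω] {P : Measure Ω} {τ : Measure UBTree} [IsProbabilityMeasure τ]
  (hX : iIndepFun X P) (hlaw : ∀ i, HasLaw (X i) τ P) {n : ℕ}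

include hX hlaw in
theorem integral_costTerm (i : ℕ) : ∫ ω, costTerm X n i ω ∂P =
    (1 - τ.real {t | t.numNodes = n}) ^ i * ∫ t, (t.numNodes : ℝ) ∂τ := by
  have h := integral_prod_range hX hlaw
    (fun l => if l < i then missInd n else fun t => (t.numNodes : ℝ)) (i + 1)
  have h1 : ∀ ω, costTerm X n i ω = ∏ l ∈ Finset.range (i + 1),
      (if l < i then missInd n else fun t => (t.numNodes : ℝ)) (X l ω) := fun ω => by
    rw [Finset.prod_range_succ, if_neg (lt_irrefl i), costTerm]
    congr 1
    exact Finset.prod_congr rfl fun l hl => by rw [if_pos (Finset.mem_range.1 hl)]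
  simp only [h1]
  rw [h, Finset.prod_range_succ, if_neg (lt_irrefl i)]
  congr 1
  rw [Finset.prod_congr rfl (g := fun _ => 1 - τ.real {t | t.numNodes = n}), Finset.prod_const,
    Finset.card_range]
  intro l hl
  rw [if_pos (Finset.mem_range.1 hl), integral_missInd]

include hX hlaw in
theorem integral_costTerm_sq (i : ℕ) : ∫ ω, costTerm X n i ω ^ 2 ∂P =
    (1 - τ.real {t | t.numNodes = n}) ^ i * ∫ t, (t.numNodes : ℝ) ^ 2 ∂τ := by
  have h := integral_prod_range hX hlaw
    (fun l => if l < i then missInd n else fun t => (t.numNodes : ℝ) ^ 2) (i + 1)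
  have h1 : ∀ ω, costTerm X n i ω ^ 2 = ∏ l ∈ Finset.range (i + 1),
      (if l < i then missInd n else fun t => (t.numNodes : ℝ) ^ 2) (X l ω) := fun ω => by
    rw [Finset.prod_range_succ, if_neg (lt_irrefl i), costTerm, mul_pow, ← Finset.prod_pow]
    congr 1
    exact Finset.prod_congr rfl fun l hl => by
      rw [if_pos (Finset.mem_range.1 hl), sq, missInd_mul_self]
  simp only [h1]
  rw [h, Finset.prod_range_succ, if_neg (lt_irrefl i)]
  congr 1
  rw [Finset.prod_congr rfl (g := fun _ => 1 - τ.real {t | t.numNodes = n}), Finset.prod_const,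
    Finset.card_range]
  intro l hl
  rw [if_pos (Finset.mem_range.1 hl), integral_missInd]

include hX hlaw in
theorem integral_costTerm_mul_costTerm {i j : ℕ} (hij : i < j) :
    ∫ ω, costTerm X n i ω * costTerm X n j ω ∂P =
      (1 - τ.real {t | t.numNodes = n}) ^ (j - 1) *
        (∫ t, (t.numNodes : ℝ) * missInd n t ∂τ) * ∫ t, (t.numNodes : ℝ) ∂τ := by
  simp only [costTerm_mul_costTerm n hij]
  rw [integral_prod_range hX hlaw (fun l => if l < j then
      fun t : UBTree => (if l = i then (t.numNodes : ℝ) else 1) * missInd n t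
        else fun t => (t.numNodes : ℝ)), Finset.prod_range_succ, if_neg (lt_irrefl j)]
  congr 1
  have hi := Finset.mem_range.2 hij
  rw [← Finset.mul_prod_erase _ _ hi, if_pos hij, mul_comm]
  simp only [if_true]
  congr 1
  rw [Finset.prod_congr rfl (g := fun _ => 1 - τ.real {t | t.numNodes = n}), Finset.prod_const,
    Finset.card_erase_of_mem hi, Finset.card_range]
  intro l hl
  obtain ⟨h1, h2⟩ := Finset.mem_erase.1 hl
  rw [if_pos (Finset.mem_range.1 h2)]
  simp only [h1, if_false, one_mul]
  exact integral_missInd n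

variable {C : ℝ} (hC : ∀ᵐ t ∂τ, (t.numNodes : ℝ) ≤ C)

omit [IsProbabilityMeasure τ] in
include hlaw hC in
theorem ae_costTerm_le : ∀ᵐ ω ∂P, ∀ i, costTerm X n i ω ≤ C := by
  rw [ae_all_iff]
  intro i
  have h : ∀ᵐ ω ∂P, ((X i ω).numNodes : ℝ) ≤ C := by
    rw [← (hlaw i).map_eq] at hC
    exact ae_of_ae_map (hlaw i).aemeasurable hC
  filter_upwards [h] with ω hω
  refine le_trans ?_ hω
  exact mul_le_of_le_one_left (Nat.cast_nonneg _)
    (Finset.prod_le_one (fun _ _ => missInd_nonneg n _) fun _ _ => missInd_le_one n _)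

omit [IsProbabilityMeasure τ] in
include hlaw in
theorem aestronglyMeasurable_costTerm (i : ℕ) : AEStronglyMeasurable (costTerm X n i) P := by
  have h : ∀ f : UBTree → ℝ, ∀ j, AEMeasurable (fun ω => f (X j ω)) P := fun f j =>
    (Measurable.of_discrete (f := f)).comp_aemeasurable (hlaw j).aemeasurable
  exact ((Finset.aemeasurable_fun_prod _ fun j _ => h (missInd n) j).mul
    (h (fun t => (t.numNodes : ℝ)) i)).aestronglyMeasurable

include hX hlaw hC in
/-- The first two moments of the cost of the trials up to the first success. -/
theorem moments_nodesBuilt (hs : 0 < τ.real {t | t.numNodes = n}) :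
    (∫ ω, (nodesBuilt n (fun i => X i ω) : ℝ) ∂P =
      (∫ t, (t.numNodes : ℝ) ∂τ) / τ.real {t | t.numNodes = n}) ∧
    Integrable (fun ω => (nodesBuilt n (fun i => X i ω) : ℝ) ^ 2) P ∧
    (∫ ω, (nodesBuilt n (fun i => X i ω) : ℝ) ^ 2 ∂P =
      (∫ t, (t.numNodes : ℝ) ^ 2 ∂τ) / τ.real {t | t.numNodes = n} +
        2 * (∫ t, (t.numNodes : ℝ) * missInd n t ∂τ) * (∫ t, (t.numNodes : ℝ) ∂τ) /
          τ.real {t | t.numNodes = n} ^ 2) := by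
  have := hX.isProbabilityMeasure
  have eZ := integral_costTerm hX hlaw (n := n)
  have eZ2 := integral_costTerm_sq hX hlaw (n := n)
  have eZZ := fun i j (hij : i < j) => integral_costTerm_mul_costTerm hX hlaw (n := n) hij
  have hsucc := ae_exists_success hX hlaw hs
  have hb := ae_costTerm_le (n := n) hlaw hC
  have hm := aestronglyMeasurable_costTerm (n := n) hlaw
  have hs1 : τ.real {t | t.numNodes = n} ≤ 1 := measureReal_le_one
  generalize τ.real {t | t.numNodes = n} = s at *
  generalize ∫ t, (t.numNodes : ℝ) ∂τ = A at *
  generalize ∫ t, (t.numNodes : ℝ) ^ 2 ∂τ = B at *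
  generalize ∫ t, (t.numNodes : ℝ) * missInd n t ∂τ = a at *
  have hnn := costTerm_nonneg (X := X) n
  have iZ : ∀ i, Integrable (costTerm X n i) P := fun i => by
    refine Integrable.of_bound (hm i) C ?_
    filter_upwards [hb] with ω hω
    rw [Real.norm_eq_abs, abs_of_nonneg (hnn i ω)]
    exact hω i
  have iZZ : ∀ i j, Integrable (fun ω => costTerm X n i ω * costTerm X n j ω) P := fun i j => by
    refine Integrable.of_bound ((hm i).mul (hm j)) (C * C) ?_
    filter_upwards [hb] with ω hω
    rw [Real.norm_eq_abs, abs_of_nonneg (mul_nonneg (hnn i ω) (hnn j ω))]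
    exact mul_le_mul (hω i) (hω j) (hnn j ω) ((hnn i ω).trans (hω i))
  set S : ℕ → Ω → ℝ := fun k ω => ∑ i ∈ Finset.range k, costTerm X n i ω with hS
  have hSnn : ∀ k ω, 0 ≤ S k ω := fun k ω => Finset.sum_nonneg fun i _ => hnn i ω
  have hSmono : ∀ ω, Monotone fun k => S k ω := fun ω => monotone_nat_of_le_succ fun k => by
    simp only [hS, Finset.sum_range_succ]
    linarith [hnn k ω]
  have hSlim : ∀ᵐ ω ∂P, ∀ᶠ k in atTop, S k ω = nodesBuilt n fun i => X i ω := by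
    filter_upwards [hsucc] with ω hω
    classical
    filter_upwards [eventually_gt_atTop (Nat.find hω)] with k hk
    exact sum_costTerm (Nat.find_spec hω) (fun j hj => Nat.find_min hω hj) hk
  have hr0 : 0 ≤ 1 - s := by linarith
  have hr1 : 1 - s < 1 := by linarith
  have hgeo := hasSum_geometric_of_lt_one hr0 hr1
  rw [sub_sub_cancel] at hgeo
  have iS : ∀ k, Integrable (S k) P := fun k => integrable_finsetSum _ fun i _ => iZ i
  have eS : ∀ k, ∫ ω, S k ω ∂P = ∑ i ∈ Finset.range k, (1 - s) ^ i * A := fun k => by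
    rw [hS, integral_finsetSum _ fun i _ => iZ i]
    exact Finset.sum_congr rfl fun i _ => eZ i
  have hSS : ∀ k ω, S (k + 1) ω ^ 2 = S k ω ^ 2 +
      (2 * ∑ i ∈ Finset.range k, costTerm X n i ω * costTerm X n k ω + costTerm X n k ω ^ 2) := by
    intro k ω
    rw [← Finset.sum_mul]
    simp only [hS, Finset.sum_range_succ]
    ring
  have iZ2 : ∀ k, Integrable (fun ω => costTerm X n k ω ^ 2) P := fun k => by
    simpa only [sq] using iZZ k k
  have iSZ : ∀ k, Integrable (fun ω =>
      2 * ∑ i ∈ Finset.range k, costTerm X n i ω * costTerm X n k ω) P := fun k =>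
    (integrable_finsetSum _ fun i _ => iZZ i k).const_mul 2
  have iS2 : ∀ k, Integrable (fun ω => S k ω ^ 2) P := by
    intro k
    induction k with
    | zero => simp [hS]
    | succ k ih =>
      simp only [hSS]
      exact ih.add ((iSZ k).add (iZ2 k))
  -- For each `j`, the `j` cross terms with `i < j` have the same expectation, hence the factor `j
  -- (1 - s) ^ (j - 1)`, which sums to `1 / s ^ 2`.
  have eS2 : ∀ k, ∫ ω, S k ω ^ 2 ∂P =
      ∑ j ∈ Finset.range k, (2 * (j * (1 - s) ^ (j - 1)) * a * A + (1 - s) ^ j * B) := by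
    intro k
    induction k with
    | zero => simp [hS]
    | succ k ih =>
      simp only [hSS]
      refine (integral_add (iS2 k) ((iSZ k).add (iZ2 k))).trans ?_
      rw [integral_add' (iSZ k) (iZ2 k), ih, eZ2,
        integral_const_mul, integral_finsetSum _ fun i _ => iZZ i k, Finset.sum_range_succ]
      congr 2
      rw [Finset.sum_congr rfl fun i hi => eZZ i k (Finset.mem_range.1 hi), Finset.sum_const,
        Finset.card_range, nsmul_eq_mul]
      ring
  have hder : HasSum (fun j : ℕ => (j : ℝ) * (1 - s) ^ (j - 1)) (1 / s ^ 2) := by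
    have h := hasSum_choose_mul_geometric_of_norm_lt_one 1 (r := 1 - s)
      (by rwa [Real.norm_eq_abs, abs_of_nonneg hr0])
    rw [← hasSum_nat_add_iff' 1]
    simpa using h
  have lim1 := (hgeo.mul_right A).tendsto_sum_nat
  have lim2 := (((hder.mul_left 2).mul_right a).mul_right A |>.add
    (hgeo.mul_right B)).tendsto_sum_nat
  simp only [← eS] at lim1
  simp only [← eS2] at lim2
  have r1 := integrable_and_integral_eq_of_monotone iS hSnn hSmono
    (by filter_upwards [hSlim] with ω hω using
      tendsto_const_nhds.congr' (hω.mono fun k hk => hk.symm)) lim1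
  have r2 := integrable_and_integral_eq_of_monotone iS2 (fun k ω => sq_nonneg _)
    (fun ω k l hkl => pow_le_pow_left₀ (hSnn k ω) (hSmono ω hkl) 2)
    (F := fun ω => (nodesBuilt n (fun i => X i ω) : ℝ) ^ 2)
    (by filter_upwards [hSlim] with ω hω using
      tendsto_const_nhds.congr' (hω.mono fun k hk => by show _ = S k ω ^ 2; rw [hk])) lim2
  refine ⟨?_, r2.1, ?_⟩
  · rw [r1.2]; ring
  · rw [r2.2]; ring

end Moments

/-! ### The law and moments of the size of a single trial. -/

namespace GrowthProcedure

variable {S : Type*} (G : GrowthProcedure S)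

/-- Below the target, the size law does not depend on the target, by `trial_reach`. -/
theorem trial_numNodes_eq_of_lt {m n : ℕ} (hmn : m < n) :
    (G.trial n).toMeasure.real {t | t.numNodes = m} = G.reachProb m - G.reachProb (m + 1) := by
  rw [eq_sub_iff_add_eq, ← G.trial_reach hmn.le, ← G.trial_reach (Nat.succ_le_of_lt hmn),
    ← measureReal_union _ (MeasurableSpace.measurableSet_top)]
  · congr 1
    ext t
    simp only [Set.mem_ofPred_eq, Set.mem_union]
    omega
  · exact Set.disjoint_left.2 fun t h h' => by simp only [Set.mem_ofPred_eq] at h h'; omega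

theorem trial_numNodes_eq_succ {n : ℕ} (hn : 1 ≤ n) :
    (G.trial n).toMeasure.real {t | t.numNodes = n + 1} = G.overshootProb n := by
  have h : (G.trial n).toMeasure.real {t | n + 2 ≤ t.numNodes} = 0 := by
    rw [measureReal_def, G.trial_overshoot hn, ENNReal.toReal_zero]
  rw [overshootProb, ← add_zero ((G.trial n).toMeasure.real {t | t.numNodes = n + 1}), ← h,
    ← measureReal_union _ (MeasurableSpace.measurableSet_top)]
  · congr 1
    ext t
    simp only [Set.mem_ofPred_eq, Set.mem_union]
    omega
  · exact Set.disjoint_left.2 fun t h h' => by simp only [Set.mem_ofPred_eq] at h h'; omega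

theorem ae_numNodes_le {n : ℕ} (hn : 1 ≤ n) :
    ∀ᵐ t ∂(G.trial n).toMeasure, t.numNodes ≤ n + 1 := by
  refine measure_mono_null (fun t ht => ?_) (G.trial_overshoot hn)
  simp only [Set.mem_compl_iff, Set.mem_ofPred_eq] at ht ⊢
  omega

theorem integral_trial {E : Type*} [NormedAddCommGroup E] [NormedSpace ℝ E] [CompleteSpace E]
    {n : ℕ} (hn : 1 ≤ n) (f : ℕ → E) : ∫ t, f t.numNodes ∂(G.trial n).toMeasure =
      ∑ m ∈ Finset.range n, (G.reachProb m - G.reachProb (m + 1)) • f m +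
        G.successProb n • f n + G.overshootProb n • f (n + 1) := by
  have h : ∀ᵐ t ∂(G.trial n).toMeasure, f t.numNodes = ∑ m ∈ Finset.range (n + 2),
      {t : UBTree | t.numNodes = m}.indicator (fun _ => f m) t := by
    filter_upwards [G.ae_numNodes_le hn] with t ht
    rw [Finset.sum_eq_single t.numNodes]
    · simp
    · intro m _ hm
      exact Set.indicator_of_notMem (fun h => hm (Eq.symm h)) _
    · intro h
      exact absurd (Finset.mem_range.2 (by omega)) h
  rw [integral_congr_ae h, integral_finsetSum _ fun m _ =>
    (integrable_const _).indicator MeasurableSpace.measurableSet_top]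
  simp only [integral_indicator_const _ MeasurableSpace.measurableSet_top]
  rw [Finset.sum_range_succ, Finset.sum_range_succ, G.trial_numNodes_eq_succ hn, successProb]
  congr 2
  exact Finset.sum_congr rfl fun m hm => by
    rw [G.trial_numNodes_eq_of_lt (Finset.mem_range.1 hm)]

theorem integral_missInd_mul_trial {n : ℕ} (hn : 1 ≤ n) (z : ℂ) :
    ∫ t, (missInd n t : ℂ) * z ^ t.numNodes ∂(G.trial n).toMeasure =
      ∑ m ∈ Finset.range n, ((G.reachProb m - G.reachProb (m + 1) : ℝ) : ℂ) * z ^ m +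
        G.overshootProb n * z ^ (n + 1) := by
  have h := G.integral_trial hn fun m => (if m = n then 0 else 1) * z ^ m
  have e : ∀ t : UBTree, (missInd n t : ℂ) * z ^ t.numNodes =
      (if t.numNodes = n then 0 else 1) * z ^ t.numNodes := fun t => by
    rw [missInd]; split_ifs <;> simp
  simp only [e]
  rw [h]
  simp only [if_true, zero_mul, smul_zero, add_zero, Complex.real_smul]
  congr 1
  · refine Finset.sum_congr rfl fun m hm => ?_
    rw [if_neg (Finset.mem_range.1 hm).ne, one_mul]
  · simp

/-- Summation by parts leaves the boundary term `-n * p n`, which cancels against `n * s n + (n + 1)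
* d n` up to `d n`. -/
theorem integral_numNodes {n : ℕ} (hn : 1 ≤ n) :
    ∫ t, (t.numNodes : ℝ) ∂(G.trial n).toMeasure =
      ∑ m ∈ Finset.range n, G.reachProb (m + 1) + G.overshootProb n := by
  have hsum : ∀ n : ℕ, ∑ m ∈ Finset.range n, (G.reachProb m - G.reachProb (m + 1)) * (m : ℝ) =
      ∑ m ∈ Finset.range n, G.reachProb (m + 1) - n * G.reachProb n := by
    intro n
    induction n with
    | zero => simp
    | succ n ih => rw [Finset.sum_range_succ, ih, Finset.sum_range_succ]; push_cast; ring
  rw [G.integral_trial hn fun m => (m : ℝ)]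
  simp only [smul_eq_mul]
  rw [hsum, G.reachProb_eq n]
  push_cast
  ring

theorem integral_numNodes_sq {n : ℕ} (hn : 1 ≤ n) :
    ∫ t, (t.numNodes : ℝ) ^ 2 ∂(G.trial n).toMeasure =
      ∑ m ∈ Finset.range n, (2 * m + 1) * G.reachProb (m + 1) +
        (2 * n + 1) * G.overshootProb n := by
  have hsum : ∀ n : ℕ, ∑ m ∈ Finset.range n, (G.reachProb m - G.reachProb (m + 1)) * (m : ℝ) ^ 2 =
      ∑ m ∈ Finset.range n, (2 * m + 1) * G.reachProb (m + 1) - n ^ 2 * G.reachProb n := by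
    intro n
    induction n with
    | zero => simp
    | succ n ih => rw [Finset.sum_range_succ, ih, Finset.sum_range_succ]; push_cast; ring
  rw [G.integral_trial hn fun m => (m : ℝ) ^ 2]
  simp only [smul_eq_mul]
  rw [hsum, G.reachProb_eq n]
  push_cast
  ring

theorem integral_numNodes_mul_missInd {n : ℕ} (hn : 1 ≤ n) :
    ∫ t, (t.numNodes : ℝ) * missInd n t ∂(G.trial n).toMeasure =
      ∫ t, (t.numNodes : ℝ) ∂(G.trial n).toMeasure - n * G.successProb n := by
  have h := G.integral_trial hn fun m => (m : ℝ) * if m = n then 0 else 1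
  rw [show ∫ t, (t.numNodes : ℝ) * missInd n t ∂(G.trial n).toMeasure = _ from h,
    G.integral_trial hn fun m => (m : ℝ)]
  have hsum : ∑ m ∈ Finset.range n, (G.reachProb m - G.reachProb (m + 1)) •
      ((m : ℝ) * if m = n then 0 else 1) =
      ∑ m ∈ Finset.range n, (G.reachProb m - G.reachProb (m + 1)) • (m : ℝ) :=
    Finset.sum_congr rfl fun m hm => by rw [if_neg (Finset.mem_range.1 hm).ne, mul_one]
  rw [hsum]
  simp only [smul_eq_mul, if_true]
  simp
  ring

end GrowthProcedure

/-! ### Asymptotics of the cost. -/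

namespace GrowthProcedure

variable {S : Type*} {G : GrowthProcedure S}

theorem HasSquareRootSurvival.tendsto_successProb_div (h : G.HasSquareRootSurvival) :
    Tendsto (fun n => G.successProb n / G.reachProb n) atTop (𝓝 (3 / 4)) :=
  -- `HasSquareRootSurvival` unfolds to `SquareRootDecay` of `reachProb`.
  SquareRootDecay.tendsto_success_ratio h G.successProb_nonneg G.overshootProb_nonneg G.reachProb_eq
    (fun _ hn => G.overshootProb_succ_le hn) (fun _ hn => G.successProb_le_overshootProb hn)

theorem HasSquareRootSurvival.tendsto_overshootProb_div (h : G.HasSquareRootSurvival) :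
    Tendsto (fun n => G.overshootProb n / G.reachProb n) atTop (𝓝 (1 / 4)) := by
  have h1 := h.tendsto_successProb_div.const_sub 1
  rw [show (1 : ℝ) - 3 / 4 = 1 / 4 by norm_num] at h1
  refine h1.congr' ?_
  filter_upwards [SquareRootDecay.eventually_pos h] with n hn
  rw [G.reachProb_eq] at hn ⊢
  field_simp
  ring

theorem HasSquareRootSurvival.eventually_successProb_pos (h : G.HasSquareRootSurvival) :
    ∀ᶠ n in atTop, 0 < G.successProb n := by
  filter_upwards [h.tendsto_successProb_div.eventually (lt_mem_nhds (a := 0) (by norm_num)),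
    SquareRootDecay.eventually_pos h] with n h1 h2
  have := mul_pos h1 h2
  rwa [div_mul_cancel₀ _ h2.ne'] at this

/-- Convergence of the characteristic functions of the rescaled cost, in terms of the trials. -/
theorem HasSquareRootSurvival.tendsto_charFun_cost (h : G.HasSquareRootSurvival) (s : ℝ) :
    Tendsto (fun n : ℕ => G.successProb n * Complex.exp (Complex.I * s / n) ^ n /
      (1 - ∫ t, (missInd n t : ℂ) * Complex.exp (Complex.I * s / n) ^ t.numNodes
        ∂(G.trial n).toMeasure)) atTop
      (𝓝 (3 / 4 * Complex.exp (Complex.I * s) /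
        (halfSymbol s - 1 / 4 * Complex.exp (Complex.I * s)))) := by
  -- The norm of `halfSymbol s` is at least its real part, so at least 1, while the subtracted term
  -- has norm 1/4.
  have hne : halfSymbol s - 1 / 4 * Complex.exp (Complex.I * s) ≠ 0 := by
    intro h0
    have h1 := one_le_re_halfSymbol s
    have h2 : ‖halfSymbol s‖ = 1 / 4 := by
      rw [sub_eq_zero.1 h0, norm_mul, mul_comm Complex.I, Complex.norm_exp_ofReal_mul_I]
      norm_num
    have h3 := Complex.re_le_norm (halfSymbol s)
    linarith
  have hs : Tendsto (fun n => ((G.successProb n / G.reachProb n : ℝ) : ℂ)) atTop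
      (𝓝 (3 / 4)) := by
    simpa [Function.comp_def] using (Complex.continuous_ofReal.tendsto _).comp h.tendsto_successProb_div
  have hd : Tendsto (fun n => ((G.overshootProb n / G.reachProb n : ℝ) : ℂ)) atTop
      (𝓝 (1 / 4)) := by
    simpa [Function.comp_def] using (Complex.continuous_ofReal.tendsto _).comp h.tendsto_overshootProb_div
  have hf := tendsto_one_sub_fail h G.reachProb_nonneg
    (G.reachProb_of_le_one zero_le_one) s
  have hz := (tendsto_exp_div_natCast s).const_mul (Complex.exp (Complex.I * s))
  rw [mul_one] at hz
  refine ((hs.mul_const (Complex.exp (Complex.I * s))).div (hf.sub (hd.mul hz)) hne).congr' ?_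
  filter_upwards [SquareRootDecay.eventually_pos h, eventually_gt_atTop 0] with n hp hn
  have hp' : (G.reachProb n : ℂ) ≠ 0 := Complex.ofReal_ne_zero.2 hp.ne'
  simp only [Pi.div_apply]
  rw [G.integral_missInd_mul_trial hn, pow_succ, exp_div_natCast_pow hn, Complex.ofReal_div,
    Complex.ofReal_div, div_mul_eq_mul_div, div_mul_eq_mul_div, ← sub_div,
    div_div_div_cancel_right₀ hp', sub_sub]

theorem HasSquareRootSurvival.tendsto_mean_numNodes (h : G.HasSquareRootSurvival) :
    Tendsto (fun n : ℕ => (∫ t, (t.numNodes : ℝ) ∂(G.trial n).toMeasure) / (n * G.reachProb n))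
      atTop (𝓝 2) := by
  -- The limit 2 is `1 / (0 + 1/2)`; the overshoot adds only `O(1 / n)`.
  have h0 := SquareRootDecay.tendsto_moment h 0
  have hd := h.tendsto_overshootProb_div.mul (tendsto_inv_atTop_nhds_zero_nat (𝕜 := ℝ))
  have := h0.add hd
  norm_num at this
  refine this.congr' ?_
  filter_upwards [SquareRootDecay.eventually_pos h, eventually_gt_atTop 0] with n hp hn
  have hn' : (n : ℝ) ≠ 0 := Nat.cast_ne_zero.2 hn.ne'
  rw [G.integral_numNodes hn]
  field_simp

theorem HasSquareRootSurvival.tendsto_mean_numNodes_sq (h : G.HasSquareRootSurvival) :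
    Tendsto (fun n : ℕ => (∫ t, (t.numNodes : ℝ) ^ 2 ∂(G.trial n).toMeasure) /
      (n ^ 2 * G.reachProb n)) atTop (𝓝 (4 / 3)) := by
  have h0 := SquareRootDecay.tendsto_moment h 0
  have h1 := SquareRootDecay.tendsto_moment h 1
  have hi := tendsto_inv_atTop_nhds_zero_nat (𝕜 := ℝ)
  -- The limit 4/3 is twice the first moment limit `1 / (1 + 1/2)`; all other terms carry a factor
  -- `1 / n`.
  have := ((h1.const_mul 2).add (h0.mul hi)).add
    (((hi.const_mul 2).add (hi.mul hi)).mul h.tendsto_overshootProb_div)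
  norm_num at this
  refine this.congr' ?_
  filter_upwards [SquareRootDecay.eventually_pos h, eventually_gt_atTop 0] with n hp hn
  have hn' : (n : ℝ) ≠ 0 := Nat.cast_ne_zero.2 hn.ne'
  have e : ∑ m ∈ Finset.range n, (2 * (m : ℝ) + 1) * G.reachProb (m + 1) =
      2 * n * ∑ m ∈ Finset.range n, G.reachProb (m + 1) * ((m : ℝ) / n) +
        ∑ m ∈ Finset.range n, G.reachProb (m + 1) := by
    rw [Finset.mul_sum, ← Finset.sum_add_distrib]
    refine Finset.sum_congr rfl fun m _ => ?_
    field_simp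
  rw [G.integral_numNodes_sq hn, e]
  field_simp

section Cost

variable {Ω : Type*} [MeasurableSpace Ω] {P : Measure Ω} [IsProbabilityMeasure P]
  {T : ℕ → ℕ → Ω → UBTree}

omit [IsProbabilityMeasure P] in
theorem IsTrialSequence.aemeasurable_nodesBuilt (hT : G.IsTrialSequence P T) (n : ℕ) :
    AEMeasurable (fun ω => (nodesBuilt n fun i => T n i ω : ℝ)) P :=
  (Measurable.of_discrete (f := fun k : ℕ => (k : ℝ))).comp_aemeasurable
    ((measurable_nodesBuilt n).comp_aemeasurable
      (aemeasurable_pi_lambda _ fun i => (hT.hasLaw n i).aemeasurable))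

theorem IsTrialSequence.moments (hT : G.IsTrialSequence P T) {n : ℕ} (hn : 0 < n)
    (hs : 0 < G.successProb n) :
    MemLp (fun ω => (nodesBuilt n fun i => T n i ω : ℝ)) 2 P ∧
    (∫ ω, (nodesBuilt n fun i => T n i ω : ℝ) ∂P =
      (∫ t, (t.numNodes : ℝ) ∂(G.trial n).toMeasure) / G.successProb n) ∧
    ProbabilityTheory.variance (fun ω => (nodesBuilt n fun i => T n i ω : ℝ)) P =
      (∫ t, (t.numNodes : ℝ) ^ 2 ∂(G.trial n).toMeasure) / G.successProb n +
        2 * ((∫ t, (t.numNodes : ℝ) ∂(G.trial n).toMeasure) - n * G.successProb n) *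
          (∫ t, (t.numNodes : ℝ) ∂(G.trial n).toMeasure) / G.successProb n ^ 2 -
        ((∫ t, (t.numNodes : ℝ) ∂(G.trial n).toMeasure) / G.successProb n) ^ 2 := by
  obtain ⟨h1, h2, h3⟩ := moments_nodesBuilt (hT.indep n) (hT.hasLaw n) (n := n) (C := n + 1)
    (by filter_upwards [G.ae_numNodes_le hn] with t ht; exact_mod_cast ht) hs
  have hL := (memLp_two_iff_integrable_sq (hT.aemeasurable_nodesBuilt n).aestronglyMeasurable).2 h2
  refine ⟨hL, h1, ?_⟩
  rw [variance_eq_sub hL, h1, ← G.integral_numNodes_mul_missInd hn, successProb, ← h3]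
  rfl

theorem HasSquareRootSurvival.tendstoInDistribution_cost (h : G.HasSquareRootSurvival)
    {ν : ProbabilityMeasure ℝ} (hν : ∀ s : ℝ, charFun (ν : Measure ℝ) s =
      3 / 4 * Complex.exp (Complex.I * s) /
        (halfSymbol s - 1 / 4 * Complex.exp (Complex.I * s)))
    (hT : G.IsTrialSequence P T) :
    TendstoInDistribution (fun (n : ℕ) ω => (nodesBuilt n fun i => T n i ω : ℝ) / n) atTop id
      (fun _ => P) (ν : Measure ℝ) where
  forall_aemeasurable n := (hT.aemeasurable_nodesBuilt n).div_const _
  aemeasurable_limit := aemeasurable_id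
  tendsto := by
    refine ProbabilityMeasure.tendsto_of_tendsto_charFun fun s => ?_
    simp only [ProbabilityMeasure.coe_mk, Measure.map_id, hν]
    refine (h.tendsto_charFun_cost s).congr' ?_
    filter_upwards [h.eventually_successProb_pos] with n hs
    have hz : ‖Complex.exp (Complex.I * s / n)‖ = 1 := by
      rw [show Complex.I * s / n = ((s / n : ℝ) : ℂ) * Complex.I by push_cast; ring,
        Complex.norm_exp_ofReal_mul_I]
    have hc := integral_exp_nodesBuilt (hT.indep n) (hT.hasLaw n) hs _ hz
    rw [successProb, ← hc, charFun_apply_real,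
      integral_map ((hT.aemeasurable_nodesBuilt n).div_const _) (by fun_prop)]
    refine integral_congr_ae (ae_of_all _ fun ω => ?_)
    simp only
    rw [← Complex.exp_nat_mul]
    congr 1
    push_cast
    ring

theorem HasSquareRootSurvival.hasCostAsymptotics (h : G.HasSquareRootSurvival)
    {ν : ProbabilityMeasure ℝ} (hν : ∀ s : ℝ, charFun (ν : Measure ℝ) s =
      3 / 4 * Complex.exp (Complex.I * s) /
        (halfSymbol s - 1 / 4 * Complex.exp (Complex.I * s)))
    (hT : G.IsTrialSequence P T) :
    HasCostAsymptotics P (fun n ω => (nodesBuilt n fun i => T n i ω : ℝ)) ν where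
  tendsto := h.tendstoInDistribution_cost hν hT
  memLp := by
    filter_upwards [h.eventually_successProb_pos, eventually_gt_atTop 0] with n hs hn
    exact (hT.moments hn hs).1
  mean := by
    refine Asymptotics.isEquivalent_of_tendsto_one ?_
    have hl := (h.tendsto_mean_numNodes.div h.tendsto_successProb_div
      (by norm_num)).div_const (8 / 3)
    rw [show (2 : ℝ) / (3 / 4) / (8 / 3) = 1 by norm_num] at hl
    refine hl.congr' ?_
    filter_upwards [h.eventually_successProb_pos, SquareRootDecay.eventually_pos h,
      eventually_gt_atTop 0] with n hs hp hn
    have hn' : (n : ℝ) ≠ 0 := Nat.cast_ne_zero.2 hn.ne'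
    simp only [Pi.div_apply]
    rw [(hT.moments hn hs).2.1]
    field_simp
  variance := by
    refine Asymptotics.isEquivalent_of_tendsto_one ?_
    have hs := h.tendsto_successProb_div
    have ha := h.tendsto_mean_numNodes
    have hb := h.tendsto_mean_numNodes_sq
    have hm := ha.div hs (by norm_num)
    have hl := (((hb.div hs (by norm_num)).add (((ha.sub hs).const_mul 2).mul ha |>.div
      (hs.pow 2) (by norm_num))).sub (hm.pow 2)).div_const (32 / 9)
    -- The three limits are `16/9`, `80/9` and `64/9`, and `16/9 + 80/9 - 64/9 = 32/9`.
    rw [show ((4 / 3 : ℝ) / (3 / 4) + 2 * (2 - 3 / 4) * 2 / (3 / 4) ^ 2 - (2 / (3 / 4)) ^ 2) /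
      (32 / 9) = 1 by norm_num] at hl
    refine hl.congr' ?_
    filter_upwards [h.eventually_successProb_pos, SquareRootDecay.eventually_pos h,
      eventually_gt_atTop 0] with n hs hp hn
    have hn' : (n : ℝ) ≠ 0 := Nat.cast_ne_zero.2 hn.ne'
    simp only [Pi.div_apply]
    rw [(hT.moments hn hs).2.2]
    field_simp

end Cost

end GrowthProcedure

theorem mainTheorem7 :
    ∃ ν : ProbabilityMeasure ℝ, IsDarlingMandelbrotSum (1 / 2) (3 / 4) ν ∧
      graftingProcedure.HasSquareRootSurvival ∧
      (∀ {Ω : Type*} [MeasurableSpace Ω] (P : Measure Ω) [IsProbabilityMeasure P]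
        (T : ℕ → ℕ → Ω → UBTree), graftingProcedure.IsTrialSequence P T →
          HasCostAsymptotics P (fun n ω => (nodesBuilt n fun i => T n i ω : ℝ)) ν) ∧
      (∀ {S : Type*} (G : GrowthProcedure S), G.HasSquareRootSurvival →
        ∀ {Ω : Type*} [MeasurableSpace Ω] (P : Measure Ω) [IsProbabilityMeasure P]
          (T : ℕ → ℕ → Ω → UBTree), G.IsTrialSequence P T →
            HasCostAsymptotics P (fun n ω => (nodesBuilt n fun i => T n i ω : ℝ)) ν) := by
  obtain ⟨ν, hν, hchar⟩ := exists_isDarlingMandelbrotSum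
  exact ⟨ν, hν, graftingProcedure_hasSquareRootSurvival,
    fun P _ T hT => graftingProcedure_hasSquareRootSurvival.hasCostAsymptotics hchar hT,
    fun G hG => fun P _ T hT => hG.hasCostAsymptotics hchar hT⟩
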